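/- For $N\ge 0$ consider the probability densities on $\mathbb R^N$ $$\mathcal P^{\rm G}(x)=\frac1{Z^{\rm G}_N}\prod_{l=1}^N e^{-x_l^2/2}\prod_{1\le j<k\le N}|x_k-x_j|,\qquad \mathcal P^{\rm L}(x)=\frac1{Z^{\rm L}_N}\prod_{l=1}^N x_l^a e^{-x_l/2}\mathbf 1_{x_l>0}\prod_{1\le j<k\le N}|x_k-x_j|\quad(a>-1),$$ where $Z_N^{\rm G}$, $Z_N^{\rm L}$ are the normalising constants (the integrals over $\mathbb R^N$ of the unnormalised densities). For $(\cdot)={\rm G},{\rm L}$ let $E_N^{(\cdot)}(k;(s,\infty))$ be the probability that exactly $k$ of $x_1,\dots,x_N$ lie in $(s,\infty)$, and for $\zeta\in\mathbb C$ put $$\Xi_N^{(\cdot)}((s,\infty);\zeta)=\sum_{k=0}^N\zeta^kE_N^{(\cdot)}(k;(s,\infty)).$$ Write $w^{\rm G}_j(x)=x^{j-1}e^{-x^2/2}/\Gamma(j/2)$ on $I^{\rm G}=(-\infty,\infty)$ and $w^{\rm L}_j(x)=x^{a+j-1}e^{-x}/\Gamma(a+j)$ on $I^{\rm L}=(0,\infty)$.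 For $s\in\mathbb R$ (case G) or $s\ge 0$ (case L) put $I_{<}=I^{(\cdot)}\cap(-\infty,s)$, $I_{>}=(s,\infty)$ and, for $j,k\ge1$, $$H_0^{(\cdot)}(j,k;s)=\int_{I_<}dx\,w_j(x)\int_{I_<}dy\,w_k(y)\,{\rm sgn}(y-x),\qquad H_2^{(\cdot)}(j,k;s)=\int_{I_>}dx\,w_j(x)\int_{I_>}dy\,w_k(y)\,{\rm sgn}(y-x),$$ $$H_1^{(\cdot)}(j,k;s)=\int_{I_<}w_j\int_{I_>}w_k-\int_{I_<}w_k\int_{I_>}w_j,\qquad \nu_j^{(\cdot)}(s)=\int_{I_<}w_j+\zeta\int_{I_>}w_j ,$$ where $w_j=w_j^{(\cdot)}$. Let $M^{(\cdot)}_N(s)=[H_0^{(\cdot)}(j,k;s)+\zeta H_1^{(\cdot)}(j,k;s)+\zeta^2H_2^{(\cdot)}(j,k;s)]_{j,k=1}^N$. Then, for every $\zeta\in\mathbb C$ and every even $N$, $$\Xi_N^{\rm G}((s,\infty);\zeta)=2^{-N/2}\,{\rm Pf}\,M_N^{\rm G}(s)\quad(s\in\mathbb R),$$ $$\Xi_N^{\rm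 L}((s,\infty);\zeta)=\prod_{j=1}^N\frac{\pi^{1/2}\,\Gamma(a+j)}{\Gamma(j/2)\,\Gamma(a+(j+1)/2)}\;{\rm Pf}\,M_N^{\rm L}(s/2)\quad(s\ge0,\ a>-1).$$ For odd $N$ the same two formulas hold, with the same prefactors, when $M_N^{\rm G}(s)$, respectively $M_N^{\rm L}(s/2)$, is replaced by the $(N+1)\times(N+1)$ skew-symmetric matrix obtained from it by adding the last column $(\nu_1,\dots,\nu_N,0)^T$ and the last row $(-\nu_1,\dots,-\nu_N,0)$, where $\nu_j=\nu_j^{\rm G}(s)$, respectively $\nu_j=\nu_j^{\rm L}(s/2)$. Here, for a $2n\times2n$ skew-symmetric matrix $A$, ${\rm Pf}\,A=\frac1{2^nn!}\sum_{\sigma\in S_{2n}}{\rm sgn}(\sigma)\prod_{i=1}^nA_{\sigma(2i-1),\sigma(2i)}$. -/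

import Mathlib

open MeasureTheory Set
open scoped BigOperators

noncomputable section

namespace OrthogonalEnsembles

/-! ## Pfaffians -/

/-- The Pfaffian of a (skew-symmetric) matrix of even size `m = 2n`,
`Pf A = (1 / (2 ^ n n!)) ∑_σ sgn σ ∏_{i < n} A (σ (2i)) (σ (2i+1))` (indices from `0`), with the
usual convention that it vanishes for odd `m`. -/
def pfaffian {m : ℕ} (A : Matrix (Fin m) (Fin m) ℂ) : ℂ :=
  if Even m then
    (1 / (2 ^ (m / 2) * (Nat.factorial (m / 2) : ℂ))) *
      ∑ σ : Equiv.Perm (Fin m), ((Equiv.Perm.sign σ : ℤ) : ℂ) *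
        ∏ i : Fin (m / 2),
          A (σ ⟨2 * i.val, by have := i.isLt; omega⟩) (σ ⟨2 * i.val + 1, by have := i.isLt; omega⟩)
  else 0

/-- The skew-symmetric bordering of an `N × N` matrix `A` by an additional last column with entries
`ν 0, …, ν (N-1), 0`, and the corresponding last row `-ν 0, …, -ν (N-1), 0`. -/
def bordered {N : ℕ} (A : Matrix (Fin N) (Fin N) ℂ) (ν : Fin N → ℂ) :
    Matrix (Fin (N + 1)) (Fin (N + 1)) ℂ :=
  Matrix.of fun j k =>
    if hj : j.val < N then
      if hk : k.val < N then A ⟨j.val, hj⟩ ⟨k.val, hk⟩ else ν ⟨j.val, hj⟩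
    else
      if hk : k.val < N then -ν ⟨k.val, hk⟩ else 0

/-! ## Eigenvalue densities and gap probabilities -/

/-- The unnormalised joint eigenvalue density
`∏_l w(x_l) ∏_{j < k} |x_k - x_j|` with one-body weight `w`. -/
def weightProd (w : ℝ → ℝ) (N : ℕ) (x : Fin N → ℝ) : ℝ :=
  (∏ l, w (x l)) * ∏ j, ∏ k ∈ Finset.Ioi j, |x k - x j|

/-- The normalisation constant, that is, the integral of `weightProd` over `ℝ^N`. -/
def partitionFn (w : ℝ → ℝ) (N : ℕ) : ℝ :=
  ∫ x : Fin N → ℝ, weightProd w N x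

/-- The joint eigenvalue law on `ℝ^N`, with density
`(1 / Z_N) ∏_l w(x_l) ∏_{j < k} |x_k - x_j|`. -/
def ensemble (w : ℝ → ℝ) (N : ℕ) : Measure (Fin N → ℝ) :=
  volume.withDensity fun x => ENNReal.ofReal ((1 / partitionFn w N) * weightProd w N x)

/-- One-body weight of the Gaussian orthogonal ensemble. -/
def weightG (x : ℝ) : ℝ := Real.exp (-x ^ 2 / 2)

/-- One-body weight of the Laguerre orthogonal ensemble with parameter `a`. -/
def weightL (a : ℝ) (x : ℝ) : ℝ := if 0 < x then x ^ a * Real.exp (-x / 2) else 0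

/-- `E_N(k; (s, ∞))`: the probability that there are exactly `k` eigenvalues in `(s, ∞)`. -/
def gapProb (w : ℝ → ℝ) (N k : ℕ) (s : ℝ) : ℝ :=
  (ensemble w N).real {x | Set.ncard {l : Fin N | s < x l} = k}

/-- The generating function `Ξ_N((s, ∞); ζ) = ∑_{k=0}^N ζ^k E_N(k; (s, ∞))`. -/
def genFun (w : ℝ → ℝ) (N : ℕ) (s : ℝ) (ζ : ℂ) : ℂ :=
  ∑ k ∈ Finset.range (N + 1), ζ ^ k * (gapProb w N k s : ℂ)

/-! ## Matrix elements, Gaussian case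

The indices `j, k` below are the `1`-based ones; the functions are used only for `j, k ≥ 1`. -/

def H0G (j k : ℕ) (s : ℝ) : ℝ :=
  1 / (Real.Gamma ((j : ℝ) / 2) * Real.Gamma ((k : ℝ) / 2)) *
    ∫ x in Iic s, x ^ (j - 1) * Real.exp (-x ^ 2 / 2) *
      ∫ y in Iic s, y ^ (k - 1) * Real.exp (-y ^ 2 / 2) * Real.sign (y - x)

def H1G (j k : ℕ) (s : ℝ) : ℝ :=
  1 / (Real.Gamma ((j : ℝ) / 2) * Real.Gamma ((k : ℝ) / 2)) *
    ((∫ x in Iic s, x ^ (j - 1) * Real.exp (-x ^ 2 / 2)) *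
        (∫ y in Ioi s, y ^ (k - 1) * Real.exp (-y ^ 2 / 2)) -
      (∫ x in Iic s, x ^ (k - 1) * Real.exp (-x ^ 2 / 2)) *
        (∫ y in Ioi s, y ^ (j - 1) * Real.exp (-y ^ 2 / 2)))

def H2G (j k : ℕ) (s : ℝ) : ℝ :=
  1 / (Real.Gamma ((j : ℝ) / 2) * Real.Gamma ((k : ℝ) / 2)) *
    ∫ x in Ioi s, x ^ (j - 1) * Real.exp (-x ^ 2 / 2) *
      ∫ y in Ioi s, y ^ (k - 1) * Real.exp (-y ^ 2 / 2) * Real.sign (y - x)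

def nuG (ζ : ℂ) (j : ℕ) (s : ℝ) : ℂ :=
  ((1 / Real.Gamma ((j : ℝ) / 2) : ℝ) : ℂ) *
    (((∫ x in Iic s, x ^ (j - 1) * Real.exp (-x ^ 2 / 2) : ℝ) : ℂ) +
      ζ * ((∫ x in Ioi s, x ^ (j - 1) * Real.exp (-x ^ 2 / 2) : ℝ) : ℂ))

/-- The matrix `[H_0(j,k;s) + ζ H_1(j,k;s) + ζ² H_2(j,k;s)]_{j,k=1}^N`, Gaussian case. -/
def matG (N : ℕ) (ζ : ℂ) (s : ℝ) : Matrix (Fin N) (Fin N) ℂ :=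
  Matrix.of fun j k =>
    (H0G (j + 1) (k + 1) s : ℂ) + ζ * (H1G (j + 1) (k + 1) s : ℂ) +
      ζ ^ 2 * (H2G (j + 1) (k + 1) s : ℂ)

/-! ## Matrix elements, Laguerre case with parameter `a` -/

def H0L (a : ℝ) (j k : ℕ) (s : ℝ) : ℝ :=
  1 / (Real.Gamma (a + j) * Real.Gamma (a + k)) *
    ∫ x in (0 : ℝ)..s, x ^ (a + j - 1) * Real.exp (-x) *
      ∫ y in (0 : ℝ)..s, y ^ (a + k - 1) * Real.exp (-y) * Real.sign (y - x)

def H1L (a : ℝ) (j k : ℕ) (s : ℝ) : ℝ :=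
  1 / (Real.Gamma (a + j) * Real.Gamma (a + k)) *
    ((∫ x in (0 : ℝ)..s, x ^ (a + j - 1) * Real.exp (-x)) *
        (∫ y in Ioi s, y ^ (a + k - 1) * Real.exp (-y)) -
      (∫ x in (0 : ℝ)..s, x ^ (a + k - 1) * Real.exp (-x)) *
        (∫ y in Ioi s, y ^ (a + j - 1) * Real.exp (-y)))

def H2L (a : ℝ) (j k : ℕ) (s : ℝ) : ℝ :=
  1 / (Real.Gamma (a + j) * Real.Gamma (a + k)) *
    ∫ x in Ioi s, x ^ (a + j - 1) * Real.exp (-x) *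
      ∫ y in Ioi s, y ^ (a + k - 1) * Real.exp (-y) * Real.sign (y - x)

def nuL (a : ℝ) (ζ : ℂ) (j : ℕ) (s : ℝ) : ℂ :=
  ((1 / Real.Gamma (a + j) : ℝ) : ℂ) *
    (((∫ x in (0 : ℝ)..s, x ^ (a + j - 1) * Real.exp (-x) : ℝ) : ℂ) +
      ζ * ((∫ x in Ioi s, x ^ (a + j - 1) * Real.exp (-x) : ℝ) : ℂ))

/-- The matrix `[H_0(j,k;s) + ζ H_1(j,k;s) + ζ² H_2(j,k;s)]_{j,k=1}^N`, Laguerre case. -/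
def matL (a : ℝ) (N : ℕ) (ζ : ℂ) (s : ℝ) : Matrix (Fin N) (Fin N) ℂ :=
  Matrix.of fun j k =>
    (H0L a (j + 1) (k + 1) s : ℂ) + ζ * (H1L a (j + 1) (k + 1) s : ℂ) +
      ζ ^ 2 * (H2L a (j + 1) (k + 1) s : ℂ)

/-- The prefactor `∏_{j=1}^N √π Γ(a+j) / (Γ(j/2) Γ(a+(j+1)/2))` of the Laguerre case. -/
def constL (a : ℝ) (N : ℕ) : ℝ :=
  ∏ j ∈ Finset.Icc 1 N, Real.sqrt Real.pi * Real.Gamma (a + j) /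
    (Real.Gamma ((j : ℝ) / 2) * Real.Gamma (a + ((j : ℝ) + 1) / 2))

end OrthogonalEnsembles

end

/-! Give each eigenvalue in $(-\infty,s]$ the factor $1$ and each one in $(s,\infty)$ the factor
$\zeta$. The generating function is then a ratio of two integrals of $\prod_l
v(x_l)\prod_{j<k}|x_k-x_j|$: above, $v$ is the weight times this marking; below, it is the same at
$\zeta=1$ (`genFun_eq_of_integral_eq`).

De Bruijn's formula turns each integral into a Pfaffian. For distinct coordinates the sign of the
Vandermonde determinant is ${\rm Pf}[{\rm sgn}(x_k-x_j)]$, bordered by ones when $N$ is odd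
(`prod_abs_eq_pfSum_of_even`, `prod_abs_eq_pfSum_of_odd`). Expanding determinant and Pfaffian and
integrating pair by pair leaves $N!$ times the Pfaffian of the skew moments $\langle
x^j,x^k\rangle_v$, bordered by $\int v\,x^j$ in the odd case. Splitting these at $s$ gives
$H_0+\zeta H_1+\zeta^2H_2$ up to a diagonal scaling (`sgnForm_mul_markFactor`, `matG_eq`,
`matL_eq`).

The Pfaffian at $\zeta=1$ is computed in closed form. For each weight $w$ there is an operator $D$,
raising degrees by one, such that $w\,Dq$ is the derivative of a function vanishing at both ends of
the support. Integration by parts then gives $\langle p,Dq\rangle_w=\mu(pq)$ for a classical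
functional $\mu$: $2\int e^{-x^2}pq$ for G, $4\int_0^\infty x^{2a+1}e^{-x}pq$ for L. With $h_n$ the
monic Hermite or Laguerre polynomials of $\mu$, the monic basis $h_0,Dh_0,h_2,Dh_2,\dots$ makes the
odd-indexed members mutually orthogonal and the even-odd block diagonal, so the Pfaffian is
$\prod_i\mu(h_{2i}^2)$, with a further factor $\int w\,h_{N-1}$ for odd $N$. The duplication formula
for $\Gamma$ rewrites this as the products `normG`, `normL`, which cancel against the scaling and
the stated prefactors. -/

noncomputable section

namespace OrthogonalEnsembles

/-! ## Pfaffian sums over permutations -/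

section Algebra

variable {m : ℕ} {ι R : Type*} [Fintype ι] [DecidableEq ι] [CommRing R]

/-- The unnormalised Pfaffian `∑_τ sgn τ ∏_i A (τ (2i)) (τ (2i+1))`, where the positions are
arranged in pairs by `e`. -/
def pfSum (e : Fin m × Fin 2 ≃ ι) (A : Matrix ι ι R) : R :=
  ∑ τ : Equiv.Perm ι, ((Equiv.Perm.sign τ : ℤ) : R) * ∏ i, A (τ (e (i, 0))) (τ (e (i, 1)))

lemma sign_mul_sign_self (τ : Equiv.Perm ι) :
    ((Equiv.Perm.sign τ : ℤ) : R) * ((Equiv.Perm.sign τ : ℤ) : R) = 1 := by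
  rw [← Int.cast_mul, ← Units.val_mul, Int.units_mul_self]; simp

lemma pfSum_submatrix_perm (e : Fin m × Fin 2 ≃ ι) (A : Matrix ι ι R) (σ : Equiv.Perm ι) :
    pfSum e (A.submatrix σ σ) = ((Equiv.Perm.sign σ : ℤ) : R) * pfSum e A := by
  unfold pfSum
  rw [Finset.mul_sum]
  conv_rhs => rw [← Equiv.sum_comp (Equiv.mulLeft σ)]
  refine Finset.sum_congr rfl fun τ _ => ?_
  have h := sign_mul_sign_self (R := R) σ
  simp only [Matrix.submatrix_apply, Equiv.coe_mulLeft, Equiv.Perm.sign_mul, Units.val_mul,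
    Int.cast_mul, Equiv.Perm.mul_apply]
  linear_combination (-(((Equiv.Perm.sign τ : ℤ) : R) *
    ∏ i, A (σ (τ (e (i, 0)))) (σ (τ (e (i, 1)))))) * h

lemma pfSum_eq_submatrix (e : Fin m × Fin 2 ≃ ι) (A : Matrix ι ι R) :
    pfSum e A = pfSum (Equiv.refl _) (A.submatrix e e) := by
  unfold pfSum
  refine Fintype.sum_equiv e.symm.permCongr _ _ fun τ => ?_
  simp [Equiv.Perm.sign_permCongr]

lemma sum_sign_mul_prod_comp (B : Matrix ι ι R) (g : ι → ι) :
    ∑ τ : Equiv.Perm ι, ((Equiv.Perm.sign τ : ℤ) : R) * ∏ x, B (τ x) (g x) =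
      (B.submatrix id g).det := by
  rw [Matrix.det_apply']
  rfl

/-- Expanding every entry of $BAB^T$ gives a sum over maps `g : ι → ι`; the sum over permutations
turns each term into a determinant of columns of $B$ selected by `g`. A repeated column gives zero,
and a permutation gives $\pm\det B$, the sign being the one required by the Pfaffian of $A$. -/
lemma pfSum_conj (e : Fin m × Fin 2 ≃ ι) (A B : Matrix ι ι R) :
    pfSum e (B * A * B.transpose) = B.det * pfSum e A := by
  have hentry : ∀ a b, (B * A * B.transpose) a b =
      ∑ p : Fin 2 → ι, B a (p 0) * B b (p 1) * A (p 0) (p 1) := by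
    intro a b
    rw [← Equiv.sum_comp (finTwoArrowEquiv ι).symm, Fintype.sum_prod_type, Finset.sum_comm]
    simp only [Matrix.mul_apply, Matrix.transpose_apply, Finset.sum_mul]
    refine Finset.sum_congr rfl fun k _ => Finset.sum_congr rfl fun l _ => ?_
    simp [finTwoArrowEquiv]; ring
  have hprod : ∀ τ : Equiv.Perm ι,
      ∏ i, (B * A * B.transpose) (τ (e (i, 0))) (τ (e (i, 1))) =
        ∑ g : ι → ι, (∏ x, B (τ x) (g x)) * ∏ i, A (g (e (i, 0))) (g (e (i, 1))) := by
    intro τ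
    simp only [hentry]
    rw [Finset.prod_univ_sum, Fintype.piFinset_univ]
    refine Fintype.sum_equiv
      ((Equiv.curry (Fin m) (Fin 2) ι).symm.trans (Equiv.arrowCongr e (Equiv.refl ι))) _ _
      fun f => ?_
    rw [Finset.prod_mul_distrib, ← Equiv.prod_comp e, Fintype.prod_prod_type]
    simp [Equiv.arrowCongr]
  unfold pfSum
  simp only [hprod, Finset.mul_sum]
  rw [Finset.sum_comm]
  have h1 : ∀ g : ι → ι, ∑ τ : Equiv.Perm ι, ((Equiv.Perm.sign τ : ℤ) : R) *
      ((∏ x, B (τ x) (g x)) * ∏ i, A (g (e (i, 0))) (g (e (i, 1)))) =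
      (B.submatrix id g).det * ∏ i, A (g (e (i, 0))) (g (e (i, 1))) := by
    intro g
    rw [← sum_sign_mul_prod_comp, Finset.sum_mul]
    exact Finset.sum_congr rfl fun τ _ => by ring
  simp only [h1]
  symm
  refine Finset.sum_of_injOn (fun σ : Equiv.Perm ι => (σ : ι → ι))
    (fun a _ b _ h => DFunLike.coe_injective h) (fun _ _ => Finset.mem_coe.2 (Finset.mem_univ _))
    (fun g _ hg => ?_) fun σ _ => ?_
  · have hninj : ¬ Function.Injective g := fun hinj => hg
      ⟨Equiv.ofBijective g (Finite.injective_iff_bijective.1 hinj), by simp, rfl⟩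
    simp only [Function.Injective, not_forall] at hninj
    obtain ⟨a, b, hab, hne⟩ := hninj
    rw [Matrix.det_zero_of_column_eq hne (fun i => by simp [hab]), zero_mul]
  · rw [Matrix.det_permute']; ring

/-- Recombination of an odd-even splitting: flips inside the pairs followed by permutations of the
first and of the second members. -/
def pairPerm (q : (Fin m → Equiv.Perm (Fin 2)) × (Fin 2 → Equiv.Perm (Fin m))) :
    Equiv.Perm (Fin m × Fin 2) :=
  Equiv.prodCongrLeft q.2 * Equiv.prodCongrRight q.1

lemma pairPerm_apply (q : (Fin m → Equiv.Perm (Fin 2)) × (Fin 2 → Equiv.Perm (Fin m)))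
    (i : Fin m) (b : Fin 2) : pairPerm q (i, b) = (q.2 (q.1 i b) i, q.1 i b) := by
  simp [pairPerm]

lemma pairPerm_injective : Function.Injective (pairPerm (m := m)) := by
  rintro ⟨ε, σ⟩ ⟨ε', σ'⟩ h
  have h1 : ∀ i b, (σ (ε i b) i, ε i b) = (σ' (ε' i b) i, ε' i b) := fun i b => by
    simpa only [pairPerm_apply] using congrArg (fun τ : Equiv.Perm _ => τ (i, b)) h
  have hε : ε = ε' := by
    ext i b
    exact congrArg Fin.val (Prod.ext_iff.1 (h1 i b)).2
  subst hε
  have hσ : σ = σ' := by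
    ext b i
    have := (Prod.ext_iff.1 (h1 i ((ε i).symm b))).1
    simpa using congrArg Fin.val this
  rw [hσ]

/-- Counting: exactly $m$ labels are of the second kind and each of the $m$ pairs contains at most
one, so each contains exactly one. -/
lemma exists_pairPerm_eq (τ : Equiv.Perm (Fin m × Fin 2))
    (h : ∀ i, ¬ ((τ (i, 0)).2 = 1 ∧ (τ (i, 1)).2 = 1)) : ∃ q, pairPerm q = τ := by
  have hle : ∀ i ∈ (Finset.univ : Finset (Fin m)),
      ((τ (i, 0)).2 : ℕ) + ((τ (i, 1)).2 : ℕ) ≤ 1 := by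
    intro i _
    have := h i
    omega
  have hsum : ∑ i : Fin m, (((τ (i, 0)).2 : ℕ) + ((τ (i, 1)).2 : ℕ)) = ∑ i : Fin m, 1 := by
    have h1 : ∑ x : Fin m × Fin 2, ((τ x).2 : ℕ) = ∑ x : Fin m × Fin 2, (x.2 : ℕ) :=
      Equiv.sum_comp τ (fun x => (x.2 : ℕ))
    rw [Fintype.sum_prod_type, Fintype.sum_prod_type] at h1
    simpa [Fin.sum_univ_two] using h1
  have hone := (Finset.sum_eq_sum_iff_of_le hle).1 hsum
  have hbij : ∀ i, Function.Bijective fun b => (τ (i, b)).2 := by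
    intro i
    refine Finite.injective_iff_bijective.1 ?_
    have := hone i (Finset.mem_univ i)
    intro b c hbc
    fin_cases b <;> fin_cases c <;> simp at hbc ⊢ <;> omega
  let ε : Fin m → Equiv.Perm (Fin 2) := fun i => Equiv.ofBijective _ (hbij i)
  -- Once the flips are undone, the permutation preserves the kind of each label and hence splits
  -- into one permutation of the first members and one of the second.
  let ρ : Equiv.Perm (Fin m × Fin 2) := τ * (Equiv.prodCongrRight ε)⁻¹
  have hρ : ∀ x, (ρ x).2 = x.2 := by
    rintro ⟨i, b⟩
    have : (Equiv.prodCongrRight ε)⁻¹ (i, b) = (i, (ε i).symm b) := by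
      rw [Equiv.Perm.inv_eq_iff_eq]; simp
    simp only [ρ, Equiv.Perm.mul_apply, this]
    exact (ε i).apply_symm_apply b
  have hσ : ∀ b, Function.Bijective fun i => (ρ (i, b)).1 := by
    intro b
    refine Finite.injective_iff_bijective.1 fun i j hij => ?_
    have : ρ (i, b) = ρ (j, b) := Prod.ext hij (by rw [hρ, hρ])
    simpa using ρ.injective this
  refine ⟨(ε, fun b => Equiv.ofBijective _ (hσ b)), ?_⟩
  have hleft : Equiv.prodCongrLeft (fun b => Equiv.ofBijective _ (hσ b)) = ρ := by
    ext x : 1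
    rcases x with ⟨i, b⟩
    exact Prod.ext rfl (hρ (i, b)).symm
  simp only [pairPerm, hleft, ρ, inv_mul_cancel_right]

lemma sum_sign_sign_prod (D : Matrix (Fin m) (Fin m) R) :
    ∑ σ : Fin 2 → Equiv.Perm (Fin m), ((Equiv.Perm.sign (σ 0) : ℤ) : R) *
      ((Equiv.Perm.sign (σ 1) : ℤ) : R) * ∏ i, D (σ 0 i) (σ 1 i) = (m.factorial : R) * D.det := by
  rw [← Equiv.sum_comp (finTwoArrowEquiv _).symm, Fintype.sum_prod_type_right]
  have : ∀ β : Equiv.Perm (Fin m), ∑ α : Equiv.Perm (Fin m), ((Equiv.Perm.sign α : ℤ) : R) *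
      ((Equiv.Perm.sign β : ℤ) : R) * ∏ i, D (α i) (β i) = D.det := by
    intro β
    have h := sum_sign_mul_prod_comp D β
    rw [Matrix.det_permute'] at h
    calc _ = ((Equiv.Perm.sign β : ℤ) : R) * ∑ τ : Equiv.Perm (Fin m),
          ((Equiv.Perm.sign τ : ℤ) : R) * ∏ x, D (τ x) (β x) := by
          rw [Finset.mul_sum]; exact Finset.sum_congr rfl fun _ _ => by ring
      _ = D.det := by rw [h, ← mul_assoc, sign_mul_sign_self, one_mul]
  have e0 : ∀ p : Equiv.Perm (Fin m) × Equiv.Perm (Fin m),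
      (finTwoArrowEquiv _).symm p 0 = p.1 := fun _ => rfl
  have e1 : ∀ p : Equiv.Perm (Fin m) × Equiv.Perm (Fin m),
      (finTwoArrowEquiv _).symm p 1 = p.2 := fun _ => rfl
  simp only [e0, e1, this]
  simp [Fintype.card_perm]

/-- The Pfaffian of a skew-symmetric matrix in which the second members of the pairs span an
isotropic subspace. -/
lemma pfSum_eq_det (e : Fin m × Fin 2 ≃ ι) (A : Matrix ι ι R) (hA : ∀ j k, A j k = -A k j)
    (h0 : ∀ i j, A (e (i, 1)) (e (j, 1)) = 0) :
    pfSum e A = 2 ^ m * (m.factorial : R) *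
      (Matrix.of fun i j => A (e (i, 0)) (e (j, 1))).det := by
  rw [pfSum_eq_submatrix]
  unfold pfSum
  obtain ⟨D, hD⟩ : ∃ D : Matrix (Fin m) (Fin m) R,
      D = Matrix.of fun i j => A (e (i, 0)) (e (j, 1)) := ⟨_, rfl⟩
  have hDa : ∀ i j, D i j = A (e (i, 0)) (e (j, 1)) := fun i j => by rw [hD]; rfl
  rw [← hD]
  have h1 := Finset.sum_of_injOn
    (s := (Finset.univ : Finset ((Fin m → Equiv.Perm (Fin 2)) × (Fin 2 → Equiv.Perm (Fin m)))))
    (t := (Finset.univ : Finset (Equiv.Perm (Fin m × Fin 2))))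
    (f := fun q => ((Equiv.Perm.sign (q.2 0) : ℤ) : R) * ((Equiv.Perm.sign (q.2 1) : ℤ) : R) *
      ∏ i, D (q.2 0 i) (q.2 1 i))
    (g := fun τ => ((Equiv.Perm.sign τ : ℤ) : R) *
      ∏ i, (A.submatrix e e) (τ (Equiv.refl _ (i, 0))) (τ (Equiv.refl _ (i, 1))))
    pairPerm pairPerm_injective.injOn (fun _ _ => Finset.mem_coe.2 (Finset.mem_univ _)) ?_ ?_
  · rw [← h1]
    simp only [Fintype.sum_prod_type, sum_sign_sign_prod]
    simp [Fintype.card_perm, mul_assoc]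
  -- A permutation outside the image of `pairPerm` puts two second members in one pair, and that
  -- factor vanishes by isotropy.
  · intro τ _ hτ
    have : ∃ i, (τ (i, 0)).2 = 1 ∧ (τ (i, 1)).2 = 1 := by
      by_contra hcon
      push Not at hcon
      obtain ⟨q, hq⟩ := exists_pairPerm_eq τ (fun i => not_and.2 (hcon i))
      exact hτ ⟨q, by simp, hq⟩
    obtain ⟨i, hi0, hi1⟩ := this
    rw [Finset.prod_eq_zero (Finset.mem_univ i), mul_zero]
    have e0 : τ (i, 0) = ((τ (i, 0)).1, 1) := Prod.ext rfl hi0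
    have e1 : τ (i, 1) = ((τ (i, 1)).1, 1) := Prod.ext rfl hi1
    simp only [Equiv.refl_apply, Matrix.submatrix_apply]
    rw [e0, e1, h0]
  · intro q _
    obtain ⟨ε, σ⟩ := q
    have hfac : ∀ i, (A.submatrix e e) (pairPerm (ε, σ) (i, 0)) (pairPerm (ε, σ) (i, 1)) =
        ((Equiv.Perm.sign (ε i) : ℤ) : R) * A (e (σ 0 i, 0)) (e (σ 1 i, 1)) := by
      intro i
      simp only [pairPerm_apply, Matrix.submatrix_apply]
      have hcases : ∀ p : Equiv.Perm (Fin 2), p = 1 ∨ p = Equiv.swap 0 1 := by decide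
      rcases hcases (ε i) with h | h
      · simp [h]
      · simpa [h] using hA _ _
    have hprod : ∏ i, (A.submatrix e e) (pairPerm (ε, σ) (Equiv.refl _ (i, 0)))
        (pairPerm (ε, σ) (Equiv.refl _ (i, 1))) =
        (∏ i, ((Equiv.Perm.sign (ε i) : ℤ) : R)) * ∏ i, A (e (σ 0 i, 0)) (e (σ 1 i, 1)) := by
      rw [← Finset.prod_mul_distrib]
      exact Finset.prod_congr rfl fun i _ => hfac i
    have hprodD : ∏ i, D (σ 0 i) (σ 1 i) = ∏ i, A (e (σ 0 i, 0)) (e (σ 1 i, 1)) :=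
      Finset.prod_congr rfl fun i _ => hDa _ _
    rw [hprod]
    dsimp only
    rw [hprodD]
    have hs : ((Equiv.Perm.sign (pairPerm (ε, σ)) : ℤ) : R) =
        ((Equiv.Perm.sign (σ 0) : ℤ) : R) * ((Equiv.Perm.sign (σ 1) : ℤ) : R) *
          ∏ i, ((Equiv.Perm.sign (ε i) : ℤ) : R) := by
      simp [pairPerm, Equiv.Perm.sign_mul, Equiv.Perm.sign_prodCongrLeft,
        Equiv.Perm.sign_prodCongrRight, Fin.prod_univ_two, Units.coe_prod]
    -- Each flip enters twice, through the sign of the permutation and through skew-symmetry, so all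
    -- $2^m$ choices of flips contribute equally.
    have hsq : (∏ i, ((Equiv.Perm.sign (ε i) : ℤ) : R)) *
        ∏ i, ((Equiv.Perm.sign (ε i) : ℤ) : R) = 1 := by
      rw [← Finset.prod_mul_distrib]
      simp [sign_mul_sign_self]
    rw [hs]
    linear_combination (-(((Equiv.Perm.sign (σ 0) : ℤ) : R) * ((Equiv.Perm.sign (σ 1) : ℤ) : R) *
      ∏ i, A (e (σ 0 i, 0)) (e (σ 1 i, 1)))) * hsq

end Algebra

/-- The pairing `(i, b) ↦ 2i + b` of the indices of an even-sized matrix. -/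
def pairEquiv {m n : ℕ} (h : m * 2 = n) : Fin m × Fin 2 ≃ Fin n :=
  finProdFinEquiv.trans (finCongr h)

lemma pairEquiv_val {m n : ℕ} (h : m * 2 = n) (x : Fin m × Fin 2) :
    (pairEquiv h x : ℕ) = x.2 + 2 * x.1 := by
  simp [pairEquiv, finProdFinEquiv]

lemma pfaffian_eq_pfSum {m n : ℕ} (h : m * 2 = n) (A : Matrix (Fin n) (Fin n) ℂ) :
    pfaffian A = 1 / (2 ^ m * (m.factorial : ℂ)) * pfSum (pairEquiv h) A := by
  have hdiv : n / 2 = m := by omega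
  unfold pfaffian pfSum
  rw [if_pos ⟨m, by omega⟩]
  simp only [hdiv]
  congr 1
  refine Finset.sum_congr rfl fun σ _ => ?_
  congr 1
  refine Fintype.prod_equiv (finCongr hdiv) _ _ fun i => ?_
  congr 2 <;> ext <;> simp [pairEquiv_val, add_comm]

/-- Subtracting the first row and column of each pair from the second is a congruence of determinant
one. It makes the second members isotropic and the first-second block the identity. The zero
diagonal is a separate hypothesis because skewness does not force it in every commutative ring. -/
lemma pfSum_eq_of_forall_lt {R : Type*} [CommRing R] {m n : ℕ} (h : m * 2 = n)
    (A : Matrix (Fin n) (Fin n) R) (hA : ∀ j k, A j k = -A k j) (hd : ∀ j, A j j = 0)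
    (h1 : ∀ j k, j < k → A j k = 1) : pfSum (pairEquiv h) A = 2 ^ m * (m.factorial : R) := by
  rw [pfSum_eq_submatrix]
  obtain ⟨S, hS⟩ : ∃ S, S = A.submatrix (pairEquiv h) (pairEquiv h) := ⟨_, rfl⟩
  rw [← hS]
  have hSskew : ∀ x y, S x y = -S y x := fun x y => by rw [hS]; exact hA _ _
  have hSlt : ∀ i j a b, i < j → S (i, a) (j, b) = 1 := by
    intro i j a b hij
    rw [hS]
    refine h1 _ _ (Fin.lt_def.2 ?_)
    rw [pairEquiv_val, pairEquiv_val]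
    have := Fin.lt_def.1 hij
    dsimp only
    omega
  have hSpair : ∀ i, S (i, 0) (i, 1) = 1 := by
    intro i
    rw [hS]
    refine h1 _ _ (Fin.lt_def.2 ?_)
    rw [pairEquiv_val, pairEquiv_val]
    simp
  have hSdiag : ∀ x, S x x = 0 := fun x => by rw [hS]; exact hd _
  have hSgt : ∀ i j a b, j < i → S (i, a) (j, b) = -1 := fun i j a b hij => by
    rw [hSskew, hSlt j i b a hij]
  have hSpair' : ∀ i, S (i, 1) (i, 0) = -1 := fun i => by rw [hSskew, hSpair]
  let B : Matrix (Fin m × Fin 2) (Fin m × Fin 2) R :=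
    Matrix.kroneckerMap (· * ·) (1 : Matrix (Fin m) (Fin m) R) !![1, 0; -1, 1]
  have hB : B.det = 1 := by
    simp only [B]
    rw [Matrix.det_kronecker]
    simp [Matrix.det_fin_two]
  have key := pfSum_conj (Equiv.refl _) S B
  rw [hB, one_mul] at key
  have hval : ∀ i a j b, (B * S * B.transpose) (i, a) (j, b) =
      ∑ a' : Fin 2, ∑ b' : Fin 2, (!![1, 0; -1, 1] : Matrix (Fin 2) (Fin 2) R) a a' *
        S (i, a') (j, b') * (!![1, 0; -1, 1] : Matrix (Fin 2) (Fin 2) R) b b' := by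
    intro i a j b
    simp only [B, Matrix.mul_apply, Fintype.sum_prod_type, Matrix.transpose_apply,
      Matrix.kroneckerMap_apply, Matrix.one_apply, ite_mul, one_mul, zero_mul, Finset.sum_mul,
      mul_ite, mul_zero, Finset.sum_ite_irrel, Finset.sum_const_zero]
    simp [Finset.sum_ite_eq, Fin.sum_univ_two]
    ring
  rw [← key, pfSum_eq_det]
  · have hD : (Matrix.of fun i j => (B * S * B.transpose) (Equiv.refl _ (i, (0 : Fin 2)))
        (Equiv.refl _ (j, (1 : Fin 2)))) = (1 : Matrix (Fin m) (Fin m) R) := by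
      ext i j
      simp only [Matrix.of_apply, Equiv.refl_apply, hval, Fin.sum_univ_two]
      rcases lt_trichotomy i j with hij | rfl | hij
      · simp [hSlt _ _ _ _ hij, Matrix.one_apply_ne hij.ne]
      · simp [hSpair, hSdiag]
      · simp [hSgt _ _ _ _ hij, Matrix.one_apply_ne hij.ne']
    rw [hD, Matrix.det_one, mul_one]
  · intro x y
    have : B * S * B.transpose = -(B * S * B.transpose).transpose := by
      have hT : S.transpose = -S := by
        ext x y
        exact hSskew y x
      rw [Matrix.transpose_mul, Matrix.transpose_mul, hT]
      simp [Matrix.mul_assoc]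
    conv_lhs => rw [this]
    rfl
  · intro i j
    simp only [Equiv.refl_apply, hval, Fin.sum_univ_two]
    rcases lt_trichotomy i j with hij | rfl | hij
    · simp [hSlt _ _ _ _ hij]
    · simp [hSpair, hSdiag, hSpair']
    · simp [hSgt _ _ _ _ hij]

/-! ## Bordered matrices -/

section Bordered

variable {N : ℕ} (A : Matrix (Fin N) (Fin N) ℂ) (ν : Fin N → ℂ)

@[simp] lemma bordered_castSucc_castSucc (j k : Fin N) :
    bordered A ν j.castSucc k.castSucc = A j k := by simp [bordered]

@[simp] lemma bordered_castSucc_last (j : Fin N) :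
    bordered A ν j.castSucc (Fin.last N) = ν j := by simp [bordered]

@[simp] lemma bordered_last_castSucc (k : Fin N) :
    bordered A ν (Fin.last N) k.castSucc = -ν k := by simp [bordered]

@[simp] lemma bordered_last_last : bordered A ν (Fin.last N) (Fin.last N) = 0 := by
  simp [bordered]

lemma bordered_skew (hA : ∀ j k, A j k = -A k j) (j k : Fin (N + 1)) :
    bordered A ν j k = -bordered A ν k j := by
  induction j using Fin.lastCases with
  | last => induction k using Fin.lastCases <;> simp
  | cast j =>
    induction k using Fin.lastCases with
    | last => simp
    | cast k => simpa using hA j k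

/-- The extension of a permutation of the first `N` indices by the last index. -/
def borderPerm (σ : Equiv.Perm (Fin N)) : Equiv.Perm (Fin (N + 1)) :=
  finSuccEquivLast.symm.permCongr σ.optionCongr

@[simp] lemma borderPerm_castSucc (σ : Equiv.Perm (Fin N)) (j : Fin N) :
    borderPerm σ j.castSucc = (σ j).castSucc := by
  simp [borderPerm, Equiv.permCongr_apply]

@[simp] lemma borderPerm_last (σ : Equiv.Perm (Fin N)) :
    borderPerm σ (Fin.last N) = Fin.last N := by
  simp [borderPerm, Equiv.permCongr_apply]

lemma sign_borderPerm (σ : Equiv.Perm (Fin N)) :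
    Equiv.Perm.sign (borderPerm σ) = Equiv.Perm.sign σ := by
  rw [borderPerm, Equiv.Perm.sign_permCongr, Equiv.optionCongr_sign]

lemma bordered_submatrix (σ : Equiv.Perm (Fin N)) :
    bordered (A.submatrix σ σ) (ν ∘ σ) =
      (bordered A ν).submatrix (borderPerm σ) (borderPerm σ) := by
  ext j k
  induction j using Fin.lastCases <;> induction k using Fin.lastCases <;> simp

end Bordered

/-! ## The sign of a Vandermonde product as a Pfaffian -/

/-- The matrix of the signs of the differences of the coordinates of `x`. -/
def signMatrix {N : ℕ} (x : Fin N → ℝ) : Matrix (Fin N) (Fin N) ℂ :=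
  Matrix.of fun j k => ((Real.sign (x k - x j) : ℝ) : ℂ)

lemma signMatrix_skew {N : ℕ} (x : Fin N → ℝ) (j k : Fin N) :
    signMatrix x j k = -signMatrix x k j := by
  simp only [signMatrix, Matrix.of_apply, ← Complex.ofReal_neg, ← Real.sign_neg, neg_sub]

lemma signMatrix_self {N : ℕ} (x : Fin N → ℝ) (j : Fin N) : signMatrix x j j = 0 := by
  simp [signMatrix]

lemma signMatrix_of_strictMono {N : ℕ} {x : Fin N → ℝ} (hx : StrictMono x) {j k : Fin N}
    (hjk : j < k) : signMatrix x j k = 1 := by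
  simp [signMatrix, Real.sign_of_pos (sub_pos.2 (hx hjk))]

/-- Sorting the coordinates multiplies both the Vandermonde determinant and $P$ by the same sign and
makes the former nonnegative. When two coordinates coincide, both sides vanish. -/
lemma prod_abs_eq_det_mul {N : ℕ} (C : ℂ) (P : (Fin N → ℝ) → ℂ)
    (hperm : ∀ (x : Fin N → ℝ) (σ : Equiv.Perm (Fin N)),
      P (x ∘ σ) = ((Equiv.Perm.sign σ : ℤ) : ℂ) * P x)
    (hmono : ∀ x, StrictMono x → P x = C) (x : Fin N → ℝ) :
    C * ((∏ j, ∏ k ∈ Finset.Ioi j, |x k - x j| : ℝ) : ℂ) =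
      (((Matrix.vandermonde x).det : ℝ) : ℂ) * P x := by
  have habs : ∀ y : Fin N → ℝ, ∏ j, ∏ k ∈ Finset.Ioi j, |y k - y j| =
      |(Matrix.vandermonde y).det| := by
    intro y
    simp [Matrix.det_vandermonde, Finset.abs_prod]
  rw [habs]
  by_cases hx : Function.Injective x
  · have hy : StrictMono (x ∘ Tuple.sort x) :=
      (Tuple.monotone_sort x).strictMono_of_injective (hx.comp (Equiv.injective _))
    have hV : (Matrix.vandermonde (x ∘ Tuple.sort x)).det =
        ((Equiv.Perm.sign (Tuple.sort x) : ℤ) : ℝ) * (Matrix.vandermonde x).det := by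
      rw [← Matrix.det_permute]
      rfl
    have hpos : 0 ≤ (Matrix.vandermonde (x ∘ Tuple.sort x)).det := by
      rw [Matrix.det_vandermonde]
      refine Finset.prod_nonneg fun j _ => Finset.prod_nonneg fun k hk => ?_
      exact (sub_pos.2 (hy (Finset.mem_Ioi.1 hk))).le
    have hVabs : |(Matrix.vandermonde x).det| = (Matrix.vandermonde (x ∘ Tuple.sort x)).det := by
      rw [← abs_of_nonneg hpos, hV, abs_mul]
      rcases Int.units_eq_one_or (Equiv.Perm.sign (Tuple.sort x)) with h | h <;> simp [h]
    have hP := hperm x (Tuple.sort x)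
    rw [hmono _ hy] at hP
    rw [hVabs, hV, hP]
    have h1 := sign_mul_sign_self (R := ℂ) (Tuple.sort x)
    push_cast
    linear_combination (P x * ((Matrix.vandermonde x).det : ℂ)) * h1
  · have : (Matrix.vandermonde x).det = 0 := by
      by_contra h0
      exact hx (Matrix.det_vandermonde_ne_zero_iff.1 h0)
    simp [this]

lemma prod_abs_eq_pfSum_of_even {m N : ℕ} (h : m * 2 = N) (x : Fin N → ℝ) :
    2 ^ m * (m.factorial : ℂ) * ((∏ j, ∏ k ∈ Finset.Ioi j, |x k - x j| : ℝ) : ℂ) =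
      (((Matrix.vandermonde x).det : ℝ) : ℂ) * pfSum (pairEquiv h) (signMatrix x) := by
  refine prod_abs_eq_det_mul _ (fun x => pfSum (pairEquiv h) (signMatrix x)) ?_ ?_ x
  · intro x σ
    exact pfSum_submatrix_perm (pairEquiv h) (signMatrix x) σ
  · intro x hx
    exact pfSum_eq_of_forall_lt h _ (signMatrix_skew x) (signMatrix_self x)
      fun j k => signMatrix_of_strictMono hx

lemma prod_abs_eq_pfSum_of_odd {m N : ℕ} (h : m * 2 = N + 1) (x : Fin N → ℝ) :
    2 ^ m * (m.factorial : ℂ) * ((∏ j, ∏ k ∈ Finset.Ioi j, |x k - x j| : ℝ) : ℂ) =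
      (((Matrix.vandermonde x).det : ℝ) : ℂ) *
        pfSum (pairEquiv h) (bordered (signMatrix x) fun _ => 1) := by
  refine prod_abs_eq_det_mul _
    (fun x => pfSum (pairEquiv h) (bordered (signMatrix x) fun _ => 1)) ?_ ?_ x
  · intro x σ
    rw [← sign_borderPerm, ← pfSum_submatrix_perm, ← bordered_submatrix]
    rfl
  · intro x hx
    refine pfSum_eq_of_forall_lt h _ (bordered_skew _ _ (signMatrix_skew x)) ?_ ?_
    · intro j
      induction j using Fin.lastCases <;> simp [signMatrix_self]
    · intro j k hjk
      induction j using Fin.lastCases with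
      | last => exact absurd hjk (not_lt.2 (Fin.le_last k))
      | cast j =>
        induction k using Fin.lastCases with
        | last => simp
        | cast k => simpa using signMatrix_of_strictMono hx (Fin.castSucc_lt_castSucc_iff.1 hjk)

/-! ## Integration over pairs of variables -/

/-- The two members of `m` pairs. -/
def sumEquivPairs (m : ℕ) : Fin m ⊕ Fin m ≃ Fin m × Fin 2 where
  toFun := Sum.elim (fun i => (i, 0)) (fun i => (i, 1))
  invFun p := if p.2 = 0 then Sum.inl p.1 else Sum.inr p.1
  left_inv := by rintro (i | i) <;> simp
  right_inv := by
    rintro ⟨i, b⟩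
    fin_cases b <;> simp

section Pairs

variable {m : ℕ} {ι : Type*}

/-- Grouping of real variables into pairs. -/
def pairsMeasurableEquiv (θ : Fin m × Fin 2 ≃ ι) : (Fin m → ℝ × ℝ) ≃ᵐ (ι → ℝ) :=
  ((MeasurableEquiv.arrowProdEquivProdArrow ℝ ℝ (Fin m)).trans
    (MeasurableEquiv.sumPiEquivProdPi fun _ : Fin m ⊕ Fin m => ℝ).symm).trans
      (MeasurableEquiv.piCongrLeft (fun _ => ℝ) ((sumEquivPairs m).trans θ))

lemma pairsMeasurableEquiv_zero (θ : Fin m × Fin 2 ≃ ι) (p : Fin m → ℝ × ℝ) (i : Fin m) :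
    pairsMeasurableEquiv θ p (θ (i, 0)) = (p i).1 :=
  Equiv.piCongrLeft_apply_apply (fun _ : ι => ℝ) ((sumEquivPairs m).trans θ) _ (Sum.inl i)

lemma pairsMeasurableEquiv_one (θ : Fin m × Fin 2 ≃ ι) (p : Fin m → ℝ × ℝ) (i : Fin m) :
    pairsMeasurableEquiv θ p (θ (i, 1)) = (p i).2 :=
  Equiv.piCongrLeft_apply_apply (fun _ : ι => ℝ) ((sumEquivPairs m).trans θ) _ (Sum.inr i)

variable [Fintype ι]

lemma measurePreserving_pairsMeasurableEquiv (θ : Fin m × Fin 2 ≃ ι) :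
    MeasurePreserving (pairsMeasurableEquiv θ) :=
  ((volume_measurePreserving_piCongrLeft (fun _ => ℝ) ((sumEquivPairs m).trans θ)).comp
    (volume_measurePreserving_sumPiEquivProdPi_symm fun _ : Fin m ⊕ Fin m => ℝ)).comp
      (volume_measurePreserving_arrowProdEquivProdArrow ℝ ℝ (Fin m))

lemma integral_prod_pairs (θ : Fin m × Fin 2 ≃ ι) (G : Fin m → ℝ × ℝ → ℂ) :
    ∫ x : ι → ℝ, ∏ i, G i (x (θ (i, 0)), x (θ (i, 1))) = ∏ i, ∫ p, G i p := by
  rw [← (measurePreserving_pairsMeasurableEquiv θ).integral_comp']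
  simp only [pairsMeasurableEquiv_zero, pairsMeasurableEquiv_one, Prod.mk.eta]
  exact integral_fintype_prod_volume_eq_prod G

lemma integrable_prod_pairs (θ : Fin m × Fin 2 ≃ ι) (G : Fin m → ℝ × ℝ → ℂ)
    (hG : ∀ i, Integrable (G i)) :
    Integrable fun x : ι → ℝ => ∏ i, G i (x (θ (i, 0)), x (θ (i, 1))) := by
  rw [← (measurePreserving_pairsMeasurableEquiv θ).integrable_comp_emb
    (MeasurableEquiv.measurableEmbedding _)]
  simp only [Function.comp_def, pairsMeasurableEquiv_zero, pairsMeasurableEquiv_one, Prod.mk.eta]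
  exact Integrable.fintype_prod hG

variable [DecidableEq ι]

/-- The integral of a product of one-body functions against a Pfaffian of two-body functions. -/
lemma integral_prod_mul_pfSum (e : Fin m × Fin 2 ≃ ι) (φ : ι → ℝ → ℂ) (ε : ι → ι → ℝ × ℝ → ℂ)
    (hint : ∀ j k, Integrable fun p : ℝ × ℝ => φ j p.1 * φ k p.2 * ε j k p)
    (ρ : Equiv.Perm ι) (hρ : ∀ j k, ε (ρ j) (ρ k) = ε j k) :
    Integrable (fun x : ι → ℝ => (∏ k, φ (ρ k) (x k)) *
        pfSum e (Matrix.of fun j k => ε j k (x j, x k))) ∧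
      ∫ x : ι → ℝ, (∏ k, φ (ρ k) (x k)) * pfSum e (Matrix.of fun j k => ε j k (x j, x k)) =
        ((Equiv.Perm.sign ρ : ℤ) : ℂ) *
          pfSum e (Matrix.of fun j k => ∫ p : ℝ × ℝ, φ j p.1 * φ k p.2 * ε j k p) := by
  let G : Equiv.Perm ι → Fin m → ℝ × ℝ → ℂ := fun τ i p =>
    φ (ρ (τ (e (i, 0)))) p.1 * φ (ρ (τ (e (i, 1)))) p.2 *
      ε (ρ (τ (e (i, 0)))) (ρ (τ (e (i, 1)))) p
  -- For fixed `τ` the variables separate into the pairs given by `e.trans τ`. Invariance of `ε`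
  -- under `ρ` lets its labels follow those of `φ`, so that each factor is an integrand of the
  -- limiting matrix.
  have hpt : ∀ x : ι → ℝ,
      (∏ k, φ (ρ k) (x k)) * pfSum e (Matrix.of fun j k => ε j k (x j, x k)) =
        ∑ τ : Equiv.Perm ι, ((Equiv.Perm.sign τ : ℤ) : ℂ) *
          ∏ i, G τ i (x ((e.trans τ) (i, 0)), x ((e.trans τ) (i, 1))) := by
    intro x
    unfold pfSum
    rw [Finset.mul_sum]
    refine Finset.sum_congr rfl fun τ _ => ?_
    rw [← Equiv.prod_comp (e.trans τ), Fintype.prod_prod_type]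
    simp only [Fin.prod_univ_two, Matrix.of_apply, Equiv.trans_apply, G, hρ,
      Finset.prod_mul_distrib]
    ring
  have hGint : ∀ τ : Equiv.Perm ι, Integrable fun x : ι → ℝ => ((Equiv.Perm.sign τ : ℤ) : ℂ) *
      ∏ i, G τ i (x ((e.trans τ) (i, 0)), x ((e.trans τ) (i, 1))) := fun τ =>
    (integrable_prod_pairs (e.trans τ) (G τ) fun i => hint _ _).const_mul _
  simp only [hpt]
  refine ⟨integrable_finsetSum _ fun τ _ => hGint τ, ?_⟩
  rw [integral_finsetSum _ fun τ _ => hGint τ, ← pfSum_submatrix_perm]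
  unfold pfSum
  refine Finset.sum_congr rfl fun τ _ => ?_
  rw [integral_const_mul, integral_prod_pairs]
  rfl

end Pairs

/-! ## The skew inner product -/

/-- The skew inner product `∫∫ f(x) g(y) sgn(y - x)`. -/
def sgnForm (f g : ℝ → ℂ) : ℂ :=
  ∫ p : ℝ × ℝ, f p.1 * g p.2 * ((Real.sign (p.2 - p.1) : ℝ) : ℂ)

lemma measurable_realSign : Measurable Real.sign := by
  unfold Real.sign
  exact Measurable.ite measurableSet_Iio measurable_const
    (Measurable.ite measurableSet_Ioi measurable_const measurable_const)

lemma abs_realSign_le_one (x : ℝ) : |Real.sign x| ≤ 1 := by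
  rcases Real.sign_apply_eq x with h | h | h <;> simp [h]

lemma integrable_mul_sign {f g : ℝ → ℂ} (hf : Integrable f) (hg : Integrable g) :
    Integrable fun p : ℝ × ℝ => f p.1 * g p.2 * ((Real.sign (p.2 - p.1) : ℝ) : ℂ) := by
  refine (hf.mul_prod hg).mul_bdd (c := 1) ?_ (Filter.Eventually.of_forall fun p => ?_)
  · exact (Complex.measurable_ofReal.comp (measurable_realSign.comp
      (measurable_snd.sub measurable_fst))).aestronglyMeasurable
  · simpa using abs_realSign_le_one _

/-! ## De Bruijn's integration formula -/

section DeBruijn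

variable {m N : ℕ} (v : ℝ → ℂ)

/-- The matrix of the skew inner products of the functions `v(x) x^j`. -/
def momentMatrix (N : ℕ) : Matrix (Fin N) (Fin N) ℂ :=
  Matrix.of fun j k => sgnForm (fun x => v x * (x : ℂ) ^ (j : ℕ)) fun x => v x * (x : ℂ) ^ (k : ℕ)

/-- The integrals of the functions `v(x) x^j`. -/
def momentVec (N : ℕ) : Fin N → ℂ := fun j => ∫ x : ℝ, v x * (x : ℂ) ^ (j : ℕ)

lemma prod_mul_det_vandermonde (x : Fin N → ℝ) :
    (∏ l, v (x l)) * (((Matrix.vandermonde x).det : ℝ) : ℂ) =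
      ∑ ρ : Equiv.Perm (Fin N), ((Equiv.Perm.sign ρ : ℤ) : ℂ) *
        ∏ k, (v (x k) * (x k : ℂ) ^ ((ρ k : Fin N) : ℕ)) := by
  rw [← Matrix.det_transpose, Matrix.det_apply', Complex.ofReal_sum, Finset.mul_sum]
  refine Finset.sum_congr rfl fun ρ _ => ?_
  rw [Finset.prod_mul_distrib]
  simp [Matrix.vandermonde_apply]
  ring

/-- Each of the $N!$ terms of the Vandermonde determinant yields the same Pfaffian of moments: the
sign from relabelling the Pfaffian cancels the sign of the term. -/
lemma integral_prod_mul_prod_abs_of_even (h : m * 2 = N)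
    (hv : ∀ j : ℕ, Integrable fun x : ℝ => v x * (x : ℂ) ^ j) :
    2 ^ m * (m.factorial : ℂ) *
      ∫ x : Fin N → ℝ, (∏ l, v (x l)) * ((∏ j, ∏ k ∈ Finset.Ioi j, |x k - x j| : ℝ) : ℂ) =
      (N.factorial : ℂ) * pfSum (pairEquiv h) (momentMatrix v N) := by
  have hT : ∀ ρ : Equiv.Perm (Fin N),
      Integrable (fun x : Fin N → ℝ => (∏ k, (v (x k) * (x k : ℂ) ^ ((ρ k : Fin N) : ℕ))) *
        pfSum (pairEquiv h) (signMatrix x)) ∧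
      ∫ x : Fin N → ℝ, (∏ k, (v (x k) * (x k : ℂ) ^ ((ρ k : Fin N) : ℕ))) *
        pfSum (pairEquiv h) (signMatrix x) =
      ((Equiv.Perm.sign ρ : ℤ) : ℂ) * pfSum (pairEquiv h) (momentMatrix v N) := by
    intro ρ
    have hint : ∀ j k : Fin N, Integrable fun p : ℝ × ℝ => v p.1 * (p.1 : ℂ) ^ (j : ℕ) *
        (v p.2 * (p.2 : ℂ) ^ (k : ℕ)) * ((Real.sign (p.2 - p.1) : ℝ) : ℂ) := by
      intro j k
      have := integrable_mul_sign (hv j) (hv k)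
      exact this
    have := integral_prod_mul_pfSum (pairEquiv h)
      (fun (j : Fin N) (x : ℝ) => v x * (x : ℂ) ^ (j : ℕ))
      (fun _ _ p => ((Real.sign (p.2 - p.1) : ℝ) : ℂ))
      hint ρ (fun _ _ => rfl)
    exact this
  rw [← integral_const_mul]
  have hpt : ∀ x : Fin N → ℝ, 2 ^ m * (m.factorial : ℂ) *
      ((∏ l, v (x l)) * ((∏ j, ∏ k ∈ Finset.Ioi j, |x k - x j| : ℝ) : ℂ)) =
      ∑ ρ : Equiv.Perm (Fin N), ((Equiv.Perm.sign ρ : ℤ) : ℂ) *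
        ((∏ k, (v (x k) * (x k : ℂ) ^ ((ρ k : Fin N) : ℕ))) *
          pfSum (pairEquiv h) (signMatrix x)) := by
    intro x
    rw [mul_left_comm, prod_abs_eq_pfSum_of_even h, ← mul_assoc, prod_mul_det_vandermonde,
      Finset.sum_mul]
    exact Finset.sum_congr rfl fun ρ _ => by ring
  simp only [hpt]
  rw [integral_finsetSum _ fun ρ _ => ((hT ρ).1.const_mul _)]
  have hterm : ∀ ρ : Equiv.Perm (Fin N), ∫ x : Fin N → ℝ, ((Equiv.Perm.sign ρ : ℤ) : ℂ) *
        ((∏ k, (v (x k) * (x k : ℂ) ^ ((ρ k : Fin N) : ℕ))) *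
          pfSum (pairEquiv h) (signMatrix x)) = pfSum (pairEquiv h) (momentMatrix v N) := by
    intro ρ
    rw [integral_const_mul]
    rw [(hT ρ).2, ← mul_assoc, sign_mul_sign_self, one_mul]
  simp only [hterm]
  simp [Fintype.card_perm]

/-- Used to append a dummy variable, which brings an odd number of variables back to an even one. -/
lemma integral_comp_castSucc_mul (F : (Fin N → ℝ) → ℂ) (g : ℝ → ℂ) :
    ∫ x : Fin (N + 1) → ℝ, F (fun k => x k.castSucc) * g (x (Fin.last N)) =
      (∫ x, F x) * ∫ y, g y := by
  have h := (volume_preserving_piFinSuccAbove (fun _ : Fin (N + 1) => ℝ) (Fin.last N))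
  have h2 := h.integral_comp' (g := fun z : ℝ × (Fin N → ℝ) => g z.1 * F z.2)
  have h3 : ∫ z : ℝ × (Fin N → ℝ), g z.1 * F z.2 = (∫ y, g y) * ∫ x, F x :=
    integral_prod_mul g F
  rw [mul_comm, ← h3, ← h2]
  refine integral_congr_ae (Filter.Eventually.of_forall fun x => ?_)
  simp only [MeasurableEquiv.piFinSuccAbove_apply, Fin.insertNthEquiv_symm_apply]
  rw [mul_comm]
  congr 2
  ext k
  simp [Fin.removeNth]

/-- A dummy variable with density `g` of total mass one carries the border index. Pairing $v\,x^j$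
with it, with $1$ in place of the sign, integrates to $\int v\,x^j$, the border entry. -/
lemma integral_prod_mul_prod_abs_of_odd (h : m * 2 = N + 1)
    (hv : ∀ j : ℕ, Integrable fun x : ℝ => v x * (x : ℂ) ^ j) :
    2 ^ m * (m.factorial : ℂ) *
      ∫ x : Fin N → ℝ, (∏ l, v (x l)) * ((∏ j, ∏ k ∈ Finset.Ioi j, |x k - x j| : ℝ) : ℂ) =
      (N.factorial : ℂ) *
        pfSum (pairEquiv h) (bordered (momentMatrix v N) (momentVec v N)) := by
  obtain ⟨g, hg, hg1⟩ : ∃ g : ℝ → ℂ, Integrable g ∧ ∫ y, g y = 1 := by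
    refine ⟨(Ioc 0 1).indicator fun _ => 1, ?_, ?_⟩
    · exact (integrable_indicator_iff measurableSet_Ioc).2 (integrableOn_const (by simp))
    · rw [integral_indicator measurableSet_Ioc]; simp
  let φ : Fin (N + 1) → ℝ → ℂ := Fin.snoc (α := fun _ => ℝ → ℂ)
    (fun (j : Fin N) (x : ℝ) => v x * (x : ℂ) ^ (j : ℕ)) g
  let ε : Fin (N + 1) → Fin (N + 1) → ℝ × ℝ → ℂ := fun j k p =>
    bordered (N := N) (Matrix.of fun _ _ => ((Real.sign (p.2 - p.1) : ℝ) : ℂ)) (fun _ => 1) j k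
  have hφc : ∀ j : Fin N, φ j.castSucc = fun x => v x * (x : ℂ) ^ (j : ℕ) := fun j => by
    simp [φ]
  have hφl : φ (Fin.last N) = g := by simp [φ]
  have hint : ∀ j k, Integrable fun p : ℝ × ℝ => φ j p.1 * φ k p.2 * ε j k p := by
    intro j k
    induction j using Fin.lastCases with
    | last =>
      induction k using Fin.lastCases with
      | last => simp [ε]
      | cast k =>
        simp only [hφc, hφl, ε, bordered_last_castSucc]
        exact (hg.mul_prod (hv k)).mul_const _
    | cast j =>
      induction k using Fin.lastCases with
      | last =>
        simp only [hφc, hφl, ε, bordered_castSucc_last]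
        exact ((hv j).mul_prod hg).mul_const _
      | cast k =>
        simp only [hφc, ε, bordered_castSucc_castSucc]
        have := integrable_mul_sign (hv j) (hv k)
        exact this
  have hε : ∀ (ρ : Equiv.Perm (Fin N)) j k, ε (borderPerm ρ j) (borderPerm ρ k) = ε j k := by
    intro ρ j k
    funext p
    induction j using Fin.lastCases <;> induction k using Fin.lastCases <;> simp [ε]
  have hA : (Matrix.of fun j k => ∫ p : ℝ × ℝ, φ j p.1 * φ k p.2 * ε j k p) =
      bordered (momentMatrix v N) (momentVec v N) := by
    ext j k
    induction j using Fin.lastCases with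
    | last =>
      induction k using Fin.lastCases with
      | last => simp [ε]
      | cast k =>
        simp only [Matrix.of_apply, hφc, hφl, ε, bordered_last_castSucc, mul_neg, mul_one]
        rw [integral_neg]
        refine congrArg _ ((integral_prod_mul g
          (fun x : ℝ => v x * (x : ℂ) ^ (k : ℕ))).trans ?_)
        rw [hg1, one_mul]; rfl
    | cast j =>
      induction k using Fin.lastCases with
      | last =>
        simp only [Matrix.of_apply, hφc, hφl, ε, bordered_castSucc_last, mul_one]
        refine (integral_prod_mul (fun x : ℝ => v x * (x : ℂ) ^ (j : ℕ)) g).trans ?_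
        rw [hg1, mul_one]; rfl
      | cast k =>
        simp only [Matrix.of_apply, hφc, ε, bordered_castSucc_castSucc]
        rfl
  have hT := fun ρ : Equiv.Perm (Fin N) =>
    integral_prod_mul_pfSum (pairEquiv h) φ ε hint (borderPerm ρ) (hε ρ)
  have hpt : ∀ x : Fin (N + 1) → ℝ, (fun x : Fin N → ℝ => 2 ^ m * (m.factorial : ℂ) *
      ((∏ l, v (x l)) * ((∏ j, ∏ k ∈ Finset.Ioi j, |x k - x j| : ℝ) : ℂ)))
        (fun k => x k.castSucc) * g (x (Fin.last N)) =
      ∑ ρ : Equiv.Perm (Fin N), ((Equiv.Perm.sign ρ : ℤ) : ℂ) *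
        ((∏ k, φ (borderPerm ρ k) (x k)) *
          pfSum (pairEquiv h) (Matrix.of fun j k => ε j k (x j, x k))) := by
    intro x
    have hmat : (Matrix.of fun j k => ε j k (x j, x k)) =
        bordered (signMatrix fun k => x k.castSucc) fun _ => 1 := by
      ext j k
      induction j using Fin.lastCases <;> induction k using Fin.lastCases <;>
        simp [ε, signMatrix]
    dsimp only
    rw [mul_left_comm, prod_abs_eq_pfSum_of_odd h, ← mul_assoc, prod_mul_det_vandermonde,
      Finset.sum_mul, Finset.sum_mul, hmat]
    refine Finset.sum_congr rfl fun ρ _ => ?_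
    rw [Fin.prod_univ_castSucc]
    simp only [borderPerm_castSucc, borderPerm_last, hφc, hφl]
    ring
  rw [← integral_const_mul, ← mul_one (∫ _, _), ← hg1, ← integral_comp_castSucc_mul]
  simp only [hpt]
  rw [integral_finsetSum _ fun ρ _ => ((hT ρ).1.const_mul _)]
  have hterm : ∀ ρ : Equiv.Perm (Fin N), ∫ x : Fin (N + 1) → ℝ,
      ((Equiv.Perm.sign ρ : ℤ) : ℂ) * ((∏ k, φ (borderPerm ρ k) (x k)) *
          pfSum (pairEquiv h) (Matrix.of fun j k => ε j k (x j, x k))) =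
      pfSum (pairEquiv h) (bordered (momentMatrix v N) (momentVec v N)) := by
    intro ρ
    rw [integral_const_mul, (hT ρ).2, sign_borderPerm, ← mul_assoc, sign_mul_sign_self, one_mul,
      hA]
  simp only [hterm]
  simp [Fintype.card_perm]

end DeBruijn

/-! ## The generating function as a ratio of Pfaffians -/

section GenFun

variable {w : ℝ → ℝ} {N : ℕ}

lemma weightProd_nonneg (hw0 : ∀ x, 0 ≤ w x) (x : Fin N → ℝ) : 0 ≤ weightProd w N x :=
  mul_nonneg (Finset.prod_nonneg fun _ _ => hw0 _)
    (Finset.prod_nonneg fun _ _ => Finset.prod_nonneg fun _ _ => abs_nonneg _)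

lemma ncard_setOf_lt_eq_sum (s : ℝ) (x : Fin N → ℝ) :
    Set.ncard {l : Fin N | s < x l} = ∑ l, if s < x l then 1 else 0 := by
  rw [Finset.sum_boole, Set.ncard_eq_toFinset_card', Set.toFinset_ofPred]
  rfl

lemma measurableSet_ncard_eq (s : ℝ) (k : ℕ) :
    MeasurableSet {x : Fin N → ℝ | Set.ncard {l : Fin N | s < x l} = k} := by
  simp only [ncard_setOf_lt_eq_sum]
  refine measurableSet_eq_fun (Finset.measurable_sum _ fun l _ => ?_) measurable_const
  exact Measurable.ite (measurableSet_lt measurable_const (measurable_pi_apply l))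
    measurable_const measurable_const

lemma gapProb_eq (hw0 : ∀ x, 0 ≤ w x) (hZ : partitionFn w N ≠ 0) (k : ℕ) (s : ℝ) :
    gapProb w N k s = 1 / partitionFn w N *
      ∫ x in {x : Fin N → ℝ | Set.ncard {l : Fin N | s < x l} = k}, weightProd w N x := by
  -- The integral of a non-integrable function is zero by convention, so a nonzero partition
  -- function forces integrability.
  have hint : Integrable (weightProd w N) := by
    by_contra h
    exact hZ (integral_undef h)
  have hpos : 0 ≤ partitionFn w N := integral_nonneg fun x => weightProd_nonneg hw0 x
  unfold gapProb ensemble Measure.real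
  rw [withDensity_apply _ (measurableSet_ncard_eq s k), ← integral_const_mul,
    integral_eq_lintegral_of_nonneg_ae]
  · exact Filter.Eventually.of_forall fun x =>
      mul_nonneg (one_div_nonneg.2 hpos) (weightProd_nonneg hw0 x)
  · exact (hint.const_mul _).aestronglyMeasurable.restrict

/-- The factor attached by the generating function to an eigenvalue at `x`. -/
def markFactor (s : ℝ) (ζ : ℂ) (x : ℝ) : ℂ := if s < x then ζ else 1

lemma sum_pow_mul_indicator (s : ℝ) (ζ : ℂ) (x : Fin N → ℝ) :
    ∑ k ∈ Finset.range (N + 1),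
      ζ ^ k * {x : Fin N → ℝ | Set.ncard {l : Fin N | s < x l} = k}.indicator (fun _ => 1) x =
      ∏ l, markFactor s ζ (x l) := by
  have hle : Set.ncard {l : Fin N | s < x l} ∈ Finset.range (N + 1) := by
    rw [Finset.mem_range, Nat.lt_succ_iff]
    exact (Set.ncard_le_card _).trans_eq (by simp)
  rw [Finset.sum_eq_single_of_mem _ hle]
  · rw [indicator_of_mem (by simp), mul_one, ncard_setOf_lt_eq_sum, ← Finset.prod_pow_eq_pow_sum]
    refine Finset.prod_congr rfl fun l _ => ?_
    unfold markFactor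
    split_ifs <;> simp
  · intro k _ hk
    rw [indicator_of_notMem (fun h => hk h.symm), mul_zero]

lemma genFun_eq (hw0 : ∀ x, 0 ≤ w x) (hZ : partitionFn w N ≠ 0) (s : ℝ) (ζ : ℂ) :
    genFun w N s ζ = 1 / (partitionFn w N : ℂ) *
      ∫ x : Fin N → ℝ, (∏ l, ((w (x l) : ℂ) * markFactor s ζ (x l))) *
        ((∏ j, ∏ k ∈ Finset.Ioi j, |x k - x j| : ℝ) : ℂ) := by
  have hint : Integrable (weightProd w N) := by
    by_contra h
    exact hZ (integral_undef h)
  have hintC : Integrable fun x => ((weightProd w N x : ℝ) : ℂ) := hint.ofReal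
  have hpt : ∀ x : Fin N → ℝ, (∏ l, ((w (x l) : ℂ) * markFactor s ζ (x l))) *
        ((∏ j, ∏ k ∈ Finset.Ioi j, |x k - x j| : ℝ) : ℂ) =
      ∑ k ∈ Finset.range (N + 1), ζ ^ k *
        {x : Fin N → ℝ | Set.ncard {l : Fin N | s < x l} = k}.indicator
          (fun x => ((weightProd w N x : ℝ) : ℂ)) x := by
    intro x
    have : ∀ k, {x : Fin N → ℝ | Set.ncard {l : Fin N | s < x l} = k}.indicator
          (fun x => ((weightProd w N x : ℝ) : ℂ)) x =
        {x : Fin N → ℝ | Set.ncard {l : Fin N | s < x l} = k}.indicator (fun _ => 1) x *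
          ((weightProd w N x : ℝ) : ℂ) := by
      intro k
      by_cases hx : x ∈ {x : Fin N → ℝ | Set.ncard {l : Fin N | s < x l} = k}
      · rw [indicator_of_mem hx, indicator_of_mem hx, one_mul]
      · rw [indicator_of_notMem hx, indicator_of_notMem hx, zero_mul]
    simp only [this, ← mul_assoc]
    rw [← Finset.sum_mul, sum_pow_mul_indicator, Finset.prod_mul_distrib, weightProd]
    push_cast
    ring
  unfold genFun
  simp only [hpt]
  rw [integral_finsetSum _ fun k _ =>
    (hintC.indicator (measurableSet_ncard_eq s k)).const_mul _, Finset.mul_sum]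
  refine Finset.sum_congr rfl fun k _ => ?_
  rw [integral_const_mul, integral_indicator (measurableSet_ncard_eq s k), integral_complex_ofReal,
    gapProb_eq hw0 hZ]
  push_cast
  ring

lemma norm_markFactor_le (s : ℝ) (ζ : ℂ) (x : ℝ) : ‖markFactor s ζ x‖ ≤ max ‖ζ‖ 1 := by
  unfold markFactor
  split_ifs <;> simp

lemma measurable_markFactor (s : ℝ) (ζ : ℂ) : Measurable (markFactor s ζ) :=
  Measurable.ite measurableSet_Ioi measurable_const measurable_const

lemma integrable_mul_markFactor_mul_pow (hint : ∀ j : ℕ, Integrable fun x => w x * x ^ j)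
    (s : ℝ) (ζ : ℂ) (j : ℕ) :
    Integrable fun x : ℝ => ((w x : ℂ) * markFactor s ζ x) * (x : ℂ) ^ j := by
  refine (((hint j).ofReal (𝕜 := ℂ)).mul_bdd
    (measurable_markFactor s ζ).aestronglyMeasurable
    (Filter.Eventually.of_forall (norm_markFactor_le s ζ))).congr
      (Filter.Eventually.of_forall fun x => ?_)
  simp only [RCLike.ofReal_mul, RCLike.ofReal_pow, Complex.coe_algebraMap]
  ring

lemma partitionFn_eq_integral (s : ℝ) : (partitionFn w N : ℂ) =
    ∫ x : Fin N → ℝ, (∏ l, ((w (x l) : ℂ) * markFactor s 1 (x l))) *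
        ((∏ j, ∏ k ∈ Finset.Ioi j, |x k - x j| : ℝ) : ℂ) := by
  unfold partitionFn
  rw [← integral_complex_ofReal]
  refine integral_congr_ae (Filter.Eventually.of_forall fun x => ?_)
  simp [weightProd, markFactor]

/-- The partition function is the marked integral at $\zeta=1$; hence `P 1 ≠ 0` also shows that it
does not vanish, and the constants cancel in the ratio. -/
lemma genFun_eq_of_integral_eq (hw0 : ∀ x, 0 ≤ w x) (s : ℝ) (ζ : ℂ) (C D : ℂ) (hC : C ≠ 0)
    (hD : D ≠ 0) (P : ℂ → ℂ) (hP : ∀ ζ, C * (∫ x : Fin N → ℝ,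
      (∏ l, ((w (x l) : ℂ) * markFactor s ζ (x l))) *
        ((∏ j, ∏ k ∈ Finset.Ioi j, |x k - x j| : ℝ) : ℂ)) = D * P ζ) (h1 : P 1 ≠ 0) :
    genFun w N s ζ = P ζ / P 1 := by
  have hZ := hP 1
  rw [← partitionFn_eq_integral] at hZ
  have hZ0 : (partitionFn w N : ℂ) ≠ 0 := by
    intro h
    rw [h, mul_zero] at hZ
    exact mul_ne_zero hD h1 hZ.symm
  rw [genFun_eq hw0 (by exact_mod_cast hZ0)]
  have h2 := hP ζ
  generalize (∫ x : Fin N → ℝ, (∏ l, ((w (x l) : ℂ) * markFactor s ζ (x l))) *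
        ((∏ j, ∏ k ∈ Finset.Ioi j, |x k - x j| : ℝ) : ℂ)) = I at h2 ⊢
  field_simp
  have : C * D * (P 1 * I) = C * D * (partitionFn w N * P ζ) := by
    linear_combination D * P 1 * h2 - D * P ζ * hZ
  linear_combination mul_left_cancel₀ (mul_ne_zero hC hD) this

lemma two_pow_mul_factorial_ne_zero (m : ℕ) : (2 : ℂ) ^ m * (m.factorial : ℂ) ≠ 0 :=
  mul_ne_zero (pow_ne_zero _ two_ne_zero) (Nat.cast_ne_zero.2 (Nat.factorial_ne_zero _))

lemma genFun_eq_of_even (hw0 : ∀ x, 0 ≤ w x) (hint : ∀ j : ℕ, Integrable fun x => w x * x ^ j)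
    (hN : Even N) (s : ℝ) (ζ : ℂ)
    (h1 : pfaffian (momentMatrix (fun x => (w x : ℂ) * markFactor s 1 x) N) ≠ 0) :
    genFun w N s ζ = pfaffian (momentMatrix (fun x => (w x : ℂ) * markFactor s ζ x) N) /
      pfaffian (momentMatrix (fun x => (w x : ℂ) * markFactor s 1 x) N) := by
  obtain ⟨m, hm⟩ := hN
  have h : m * 2 = N := by omega
  refine genFun_eq_of_integral_eq hw0 s ζ 1 (N.factorial : ℂ) one_ne_zero
    (Nat.cast_ne_zero.2 (Nat.factorial_ne_zero _))
    (fun ζ => pfaffian (momentMatrix (fun x => (w x : ℂ) * markFactor s ζ x) N)) (fun ζ => ?_) h1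
  have := integral_prod_mul_prod_abs_of_even (fun x => (w x : ℂ) * markFactor s ζ x) h
    (integrable_mul_markFactor_mul_pow hint s ζ)
  rw [pfaffian_eq_pfSum h, one_mul, mul_left_comm, ← this, ← mul_assoc,
    one_div_mul_cancel (two_pow_mul_factorial_ne_zero m), one_mul]

lemma genFun_eq_of_odd (hw0 : ∀ x, 0 ≤ w x) (hint : ∀ j : ℕ, Integrable fun x => w x * x ^ j)
    (hN : Odd N) (s : ℝ) (ζ : ℂ)
    (h1 : pfaffian (bordered (momentMatrix (fun x => (w x : ℂ) * markFactor s 1 x) N)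
      (momentVec (fun x => (w x : ℂ) * markFactor s 1 x) N)) ≠ 0) :
    genFun w N s ζ = pfaffian (bordered (momentMatrix (fun x => (w x : ℂ) * markFactor s ζ x) N)
        (momentVec (fun x => (w x : ℂ) * markFactor s ζ x) N)) /
      pfaffian (bordered (momentMatrix (fun x => (w x : ℂ) * markFactor s 1 x) N)
        (momentVec (fun x => (w x : ℂ) * markFactor s 1 x) N)) := by
  obtain ⟨m, hm⟩ := hN
  have h : (m + 1) * 2 = N + 1 := by omega
  refine genFun_eq_of_integral_eq hw0 s ζ 1 (N.factorial : ℂ) one_ne_zero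
    (Nat.cast_ne_zero.2 (Nat.factorial_ne_zero _))
    (fun ζ => pfaffian (bordered (momentMatrix (fun x => (w x : ℂ) * markFactor s ζ x) N)
        (momentVec (fun x => (w x : ℂ) * markFactor s ζ x) N))) (fun ζ => ?_) h1
  have := integral_prod_mul_prod_abs_of_odd (fun x => (w x : ℂ) * markFactor s ζ x) h
    (integrable_mul_markFactor_mul_pow hint s ζ)
  rw [pfaffian_eq_pfSum h, one_mul, mul_left_comm, ← this, ← mul_assoc,
    one_div_mul_cancel (two_pow_mul_factorial_ne_zero _), one_mul]

end GenFun

/-! ## Pfaffians under congruence -/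

section Congruence

variable {N : ℕ}

lemma pfaffian_conj (hN : Even N) (A B : Matrix (Fin N) (Fin N) ℂ) :
    pfaffian (B * A * B.transpose) = B.det * pfaffian A := by
  obtain ⟨m, hm⟩ := hN
  have h : m * 2 = N := by omega
  rw [pfaffian_eq_pfSum h, pfaffian_eq_pfSum h, pfSum_conj]
  ring

lemma bordered_eq_fromBlocks (A : Matrix (Fin N) (Fin N) ℂ) (ν : Fin N → ℂ) :
    bordered A ν = (Matrix.fromBlocks A (Matrix.of fun j (_ : Fin 1) => ν j)
      (Matrix.of fun (_ : Fin 1) k => -ν k) 0).submatrix finSumFinEquiv.symm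
        finSumFinEquiv.symm := by
  have hl : finSumFinEquiv.symm (Fin.last N) = (Sum.inr 0 : Fin N ⊕ Fin 1) :=
    finSumFinEquiv_symm_last
  have hc : ∀ j : Fin N, finSumFinEquiv.symm j.castSucc = (Sum.inl j : Fin N ⊕ Fin 1) :=
    fun j => finSumFinEquiv_symm_apply_castAdd (n := 1) j
  ext j k
  induction j using Fin.lastCases <;> induction k using Fin.lastCases <;> simp [hl, hc]

/-- Congruence by $B\oplus 1$, which has the determinant of $B$ and acts on the border as $B$ acts
on the vector. -/
lemma pfaffian_bordered_conj (hN : Odd N) (A B : Matrix (Fin N) (Fin N) ℂ) (ν : Fin N → ℂ) :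
    pfaffian (bordered (B * A * B.transpose) (B.mulVec ν)) =
      B.det * pfaffian (bordered A ν) := by
  have hdet : ((Matrix.fromBlocks B 0 0 (1 : Matrix (Fin 1) (Fin 1) ℂ)).submatrix
      finSumFinEquiv.symm finSumFinEquiv.symm).det = B.det := by
    rw [Matrix.det_submatrix_equiv_self, Matrix.det_fromBlocks_zero₂₁, Matrix.det_one, mul_one]
  rw [← hdet, ← pfaffian_conj hN.add_one]
  congr 1
  rw [bordered_eq_fromBlocks, bordered_eq_fromBlocks, Matrix.transpose_submatrix,
    Matrix.submatrix_mul_equiv, Matrix.submatrix_mul_equiv, Matrix.fromBlocks_transpose,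
    Matrix.fromBlocks_multiply, Matrix.fromBlocks_multiply]
  congr 2
  · simp
  · ext j k
    simp [Matrix.mul_apply, Matrix.mulVec, dotProduct]
  · ext j k
    simp [Matrix.mul_apply, Matrix.mulVec, dotProduct, mul_comm]
  · simp

/-- Even indices are the first members of the pairs, odd indices the second. Nothing is asked of the
even-even entries beyond skewness; indeed they need not vanish in the Laguerre case. -/
lemma pfaffian_eq_prod {m : ℕ} (h : m * 2 = N) (A : Matrix (Fin N) (Fin N) ℂ) (d : ℕ → ℂ)
    (hA : ∀ j k, A j k = -A k j)
    (hodd : ∀ j k : Fin N, Odd (j : ℕ) → Odd (k : ℕ) → A j k = 0)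
    (heven : ∀ (i j : ℕ) (hi : 2 * i < N) (hj : 2 * j + 1 < N),
      A ⟨2 * i, hi⟩ ⟨2 * j + 1, hj⟩ = if i = j then d i else 0) :
    pfaffian A = ∏ i ∈ Finset.range m, d i := by
  rw [pfaffian_eq_pfSum h, pfSum_eq_det _ _ hA]
  · have hD : (Matrix.of fun i j => A (pairEquiv h (i, 0)) (pairEquiv h (j, 1))) =
        Matrix.diagonal fun i : Fin m => d i := by
      ext i j
      have h0 : pairEquiv h (i, 0) = ⟨2 * i, by omega⟩ := by ext; simp [pairEquiv_val]
      have h1 : pairEquiv h (j, 1) = ⟨2 * j + 1, by omega⟩ := by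
        ext; simp [pairEquiv_val, add_comm]
      rw [Matrix.of_apply, h0, h1, heven]
      simp [Matrix.diagonal_apply, Fin.ext_iff]
    rw [hD, Matrix.det_diagonal, ← mul_assoc,
      one_div_mul_cancel (two_pow_mul_factorial_ne_zero m), one_mul, Finset.prod_range]
  · intro i j
    refine hodd _ _ ⟨i, ?_⟩ ⟨j, ?_⟩ <;> simp [pairEquiv_val, add_comm]

/-- The border index is the second member of the last pair, next to $2m$, and stays isotropic
because $\nu$ vanishes at odd indices. Its column may be nonzero at all even indices, so the block
is only upper triangular. -/
lemma pfaffian_bordered_eq_prod {m : ℕ} (h : N = 2 * m + 1) (A : Matrix (Fin N) (Fin N) ℂ)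
    (ν : Fin N → ℂ) (d : ℕ → ℂ) (hA : ∀ j k, A j k = -A k j)
    (hodd : ∀ j k : Fin N, Odd (j : ℕ) → Odd (k : ℕ) → A j k = 0)
    (heven : ∀ (i j : ℕ) (hi : 2 * i < N) (hj : 2 * j + 1 < N),
      A ⟨2 * i, hi⟩ ⟨2 * j + 1, hj⟩ = if i = j then d i else 0)
    (hν : ∀ j : Fin N, Odd (j : ℕ) → ν j = 0) :
    pfaffian (bordered A ν) = (∏ i ∈ Finset.range m, d i) * ν ⟨2 * m, by omega⟩ := by
  have h2 : (m + 1) * 2 = N + 1 := by omega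
  have h0 : ∀ i, pairEquiv h2 (i, 0) = (⟨2 * i, by omega⟩ : Fin N).castSucc := by
    intro i; ext; simp [pairEquiv_val]
  have h1 : ∀ j : Fin m, pairEquiv h2 (j.castSucc, 1) =
      (⟨2 * j + 1, by omega⟩ : Fin N).castSucc := by
    intro j; ext; simp [pairEquiv_val, add_comm]
  have h1l : pairEquiv h2 (Fin.last m, 1) = Fin.last N := by
    ext; simp [pairEquiv_val]; omega
  rw [pfaffian_eq_pfSum h2, pfSum_eq_det _ _ (bordered_skew A ν hA)]
  · rw [← mul_assoc, one_div_mul_cancel (two_pow_mul_factorial_ne_zero _), one_mul,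
      Matrix.det_of_isUpperTriangular, Fin.prod_univ_castSucc, Finset.prod_range]
    · congr 1
      · refine Finset.prod_congr rfl fun i _ => ?_
        rw [Matrix.of_apply, h0, h1, bordered_castSucc_castSucc]
        exact (heven _ _ _ _).trans (if_pos rfl)
      · rw [Matrix.of_apply, h0, h1l, bordered_castSucc_last]
        rfl
    · intro i j hij
      replace hij : j < i := hij
      induction j using Fin.lastCases with
      | last => exact absurd hij (not_lt.2 (Fin.le_last i))
      | cast j =>
        rw [Matrix.of_apply, h0, h1, bordered_castSucc_castSucc, heven, if_neg]
        have := Fin.lt_def.1 hij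
        rw [Fin.val_castSucc] at this
        omega
  · intro i j
    induction i using Fin.lastCases with
    | last =>
      induction j using Fin.lastCases with
      | last => rw [h1l, bordered_last_last]
      | cast j => rw [h1l, h1, bordered_last_castSucc, hν _ ⟨j, rfl⟩, neg_zero]
    | cast i =>
      induction j using Fin.lastCases with
      | last => rw [h1l, h1, bordered_castSucc_last, hν _ ⟨i, rfl⟩]
      | cast j => rw [h1, h1, bordered_castSucc_castSucc, hodd _ _ ⟨i, rfl⟩ ⟨j, rfl⟩]

end Congruence

/-! ## Polynomial functionals -/

section Functionals

open Polynomial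

variable {w : ℝ → ℝ}

lemma integrable_mul_eval (hint : ∀ j : ℕ, Integrable fun x => w x * x ^ j) (p : ℝ[X]) :
    Integrable fun x => w x * p.eval x := by
  simp only [Polynomial.eval_eq_sum_range, Finset.mul_sum]
  refine integrable_finsetSum _ fun j _ => ((hint j).const_mul (p.coeff j)).congr
    (Filter.Eventually.of_forall fun x => by ring)

/-- The functional `p ↦ ∫ w p`. -/
def polyIntegral (hint : ∀ j : ℕ, Integrable fun x => w x * x ^ j) : ℝ[X] →ₗ[ℝ] ℝ where
  toFun p := ∫ x, w x * p.eval x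
  map_add' p q := by
    rw [← integral_add (integrable_mul_eval hint p) (integrable_mul_eval hint q)]
    simp only [eval_add, mul_add]
  map_smul' c p := by
    rw [RingHom.id_apply, smul_eq_mul, ← integral_const_mul]
    refine integral_congr_ae (Filter.Eventually.of_forall fun x => ?_)
    simp only [eval_smul, smul_eq_mul]
    ring

lemma polyIntegral_apply (hint : ∀ j : ℕ, Integrable fun x => w x * x ^ j) (p : ℝ[X]) :
    polyIntegral hint p = ∫ x, w x * p.eval x := rfl

lemma integrable_mul_eval_sign (hint : ∀ j : ℕ, Integrable fun x => w x * x ^ j) (p q : ℝ[X]) :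
    Integrable fun z : ℝ × ℝ =>
      (w z.1 * p.eval z.1) * (w z.2 * q.eval z.2) * Real.sign (z.2 - z.1) := by
  refine ((integrable_mul_eval hint p).mul_prod (integrable_mul_eval hint q)).mul_bdd (c := 1)
    ?_ (Filter.Eventually.of_forall fun z => abs_realSign_le_one _)
  exact (measurable_realSign.comp (measurable_snd.sub measurable_fst)).aestronglyMeasurable

/-- The skew inner product `∫∫ w(x) p(x) w(y) q(y) sgn(y - x)` of polynomials. -/
def polyForm (hint : ∀ j : ℕ, Integrable fun x => w x * x ^ j) : ℝ[X] →ₗ[ℝ] ℝ[X] →ₗ[ℝ] ℝ :=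
  LinearMap.mk₂ ℝ (fun p q => ∫ z : ℝ × ℝ,
      (w z.1 * p.eval z.1) * (w z.2 * q.eval z.2) * Real.sign (z.2 - z.1))
    (fun p p' q => by
      rw [← integral_add (integrable_mul_eval_sign hint p q) (integrable_mul_eval_sign hint p' q)]
      refine integral_congr_ae (Filter.Eventually.of_forall fun x => ?_)
      simp only [eval_add]
      ring)
    (fun c p q => by
      rw [smul_eq_mul, ← integral_const_mul]
      refine integral_congr_ae (Filter.Eventually.of_forall fun x => ?_)
      simp only [eval_smul, smul_eq_mul]
      ring)
    (fun p q q' => by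
      rw [← integral_add (integrable_mul_eval_sign hint p q) (integrable_mul_eval_sign hint p q')]
      refine integral_congr_ae (Filter.Eventually.of_forall fun x => ?_)
      simp only [eval_add]
      ring)
    (fun c p q => by
      rw [smul_eq_mul, ← integral_const_mul]
      refine integral_congr_ae (Filter.Eventually.of_forall fun x => ?_)
      simp only [eval_smul, smul_eq_mul]
      ring)

lemma polyForm_apply (hint : ∀ j : ℕ, Integrable fun x => w x * x ^ j) (p q : ℝ[X]) :
    polyForm hint p q = ∫ z : ℝ × ℝ,
      (w z.1 * p.eval z.1) * (w z.2 * q.eval z.2) * Real.sign (z.2 - z.1) := rfl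

lemma momentMatrix_eq_polyForm (hint : ∀ j : ℕ, Integrable fun x => w x * x ^ j) (s : ℝ) (N : ℕ)
    (j k : Fin N) : momentMatrix (fun x => (w x : ℂ) * markFactor s 1 x) N j k =
      (polyForm hint (X ^ (j : ℕ)) (X ^ (k : ℕ)) : ℂ) := by
  rw [polyForm_apply, ← integral_complex_ofReal]
  refine integral_congr_ae (Filter.Eventually.of_forall fun z => ?_)
  simp [markFactor]

lemma momentVec_eq_polyIntegral (hint : ∀ j : ℕ, Integrable fun x => w x * x ^ j) (s : ℝ) (N : ℕ)
    (j : Fin N) : momentVec (fun x => (w x : ℂ) * markFactor s 1 x) N j =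
      (polyIntegral hint (X ^ (j : ℕ)) : ℂ) := by
  rw [polyIntegral_apply, ← integral_complex_ofReal]
  refine integral_congr_ae (Filter.Eventually.of_forall fun z => ?_)
  simp [markFactor]

lemma polyForm_skew (hint : ∀ j : ℕ, Integrable fun x => w x * x ^ j) (p q : ℝ[X]) :
    polyForm hint p q = -polyForm hint q p := by
  rw [polyForm_apply, polyForm_apply, ← integral_neg]
  refine (integral_prod_swap (μ := (volume : Measure ℝ)) (ν := (volume : Measure ℝ))
    (fun z : ℝ × ℝ => (w z.1 * p.eval z.1) * (w z.2 * q.eval z.2) *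
      Real.sign (z.2 - z.1))).symm.trans ?_
  refine integral_congr_ae (Filter.Eventually.of_forall fun z => ?_)
  simp only [Prod.fst_swap, Prod.snd_swap]
  rw [← neg_sub z.2 z.1, Real.sign_neg]
  ring

/-- The matrix of coefficients of the polynomials `R 0, …, R (N-1)`. -/
def coeffMatrix (R : ℕ → ℝ[X]) (N : ℕ) : Matrix (Fin N) (Fin N) ℂ :=
  Matrix.of fun j k => (((R j).coeff k : ℝ) : ℂ)

lemma det_coeffMatrix {R : ℕ → ℝ[X]} (hR : ∀ n, (R n).Monic) (hdeg : ∀ n, (R n).natDegree = n)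
    (N : ℕ) : (coeffMatrix R N).det = 1 := by
  rw [Matrix.det_of_isLowerTriangular]
  · refine Finset.prod_eq_one fun j _ => ?_
    have := (hR j).coeff_natDegree
    rw [hdeg] at this
    simp [coeffMatrix, this]
  · intro j k hjk
    replace hjk : j < k := hjk
    simp only [coeffMatrix, Matrix.of_apply]
    rw [coeff_eq_zero_of_natDegree_lt (by rw [hdeg]; exact hjk), Complex.ofReal_zero]

lemma eq_sum_coeff_smul {p : ℝ[X]} {N : ℕ} (hp : p.natDegree < N) :
    p = ∑ k : Fin N, p.coeff k • X ^ (k : ℕ) := by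
  conv_lhs => rw [p.as_sum_range' N hp]
  rw [Finset.sum_range]
  exact Finset.sum_congr rfl fun k _ => by rw [smul_X_eq_monomial]

/-- Change of basis from monomials to the polynomials `R`; for monic `R` of degree $n$ it is
unimodular and leaves the Pfaffian unchanged. -/
lemma coeffMatrix_conj (hint : ∀ j : ℕ, Integrable fun x => w x * x ^ j) (s : ℝ) (N : ℕ)
    {R : ℕ → ℝ[X]} (hdeg : ∀ n, (R n).natDegree = n) (j k : Fin N) :
    (coeffMatrix R N * momentMatrix (fun x => (w x : ℂ) * markFactor s 1 x) N *
      (coeffMatrix R N).transpose) j k = (polyForm hint (R j) (R k) : ℂ) := by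
  have hj := eq_sum_coeff_smul (p := R j) (N := N) (by rw [hdeg]; exact j.2)
  have hk := eq_sum_coeff_smul (p := R k) (N := N) (by rw [hdeg]; exact k.2)
  conv_rhs => rw [hj, hk]
  simp only [Matrix.mul_apply, momentMatrix_eq_polyForm hint, map_sum, map_smul,
    LinearMap.sum_apply, LinearMap.smul_apply, smul_eq_mul, Complex.ofReal_sum,
    Complex.ofReal_mul, Matrix.transpose_apply, coeffMatrix, Matrix.of_apply, Finset.sum_mul,
    Finset.mul_sum]
  refine Finset.sum_congr rfl fun a _ => Finset.sum_congr rfl fun b _ => ?_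
  ring

lemma coeffMatrix_mulVec (hint : ∀ j : ℕ, Integrable fun x => w x * x ^ j) (s : ℝ) (N : ℕ)
    {R : ℕ → ℝ[X]} (hdeg : ∀ n, (R n).natDegree = n) (j : Fin N) :
    (coeffMatrix R N).mulVec (momentVec (fun x => (w x : ℂ) * markFactor s 1 x) N) j =
      (polyIntegral hint (R j) : ℂ) := by
  have hj := eq_sum_coeff_smul (p := R j) (N := N) (by rw [hdeg]; exact j.2)
  conv_rhs => rw [hj]
  simp only [Matrix.mulVec, dotProduct, momentVec_eq_polyIntegral hint, map_sum, map_smul,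
    smul_eq_mul, Complex.ofReal_sum, Complex.ofReal_mul, coeffMatrix, Matrix.of_apply]

/-- The skew-orthogonal polynomials built from orthogonal polynomials `h` and a first order
differential operator `D`. -/
def skewPoly (h : ℕ → ℝ[X]) (D : ℝ[X] → ℝ[X]) (n : ℕ) : ℝ[X] :=
  if Even n then h n else D (h (n - 1))

variable {h : ℕ → ℝ[X]} {D : ℝ[X] → ℝ[X]}

lemma skewPoly_even (i : ℕ) : skewPoly h D (2 * i) = h (2 * i) := if_pos ⟨i, by ring⟩

lemma skewPoly_odd (i : ℕ) : skewPoly h D (2 * i + 1) = D (h (2 * i)) := by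
  rw [skewPoly, if_neg (by simp)]
  simp

lemma monic_skewPoly (hmonic : ∀ n, (h n).Monic) (hD : ∀ p : ℝ[X], p.Monic → (D p).Monic) (n : ℕ) :
    (skewPoly h D n).Monic := by
  unfold skewPoly
  split_ifs
  exacts [hmonic n, hD _ (hmonic _)]

lemma natDegree_skewPoly (hmonic : ∀ n, (h n).Monic) (hdeg : ∀ n, (h n).natDegree = n)
    (hD : ∀ p : ℝ[X], p.Monic → (D p).natDegree = p.natDegree + 1) (n : ℕ) :
    (skewPoly h D n).natDegree = n := by
  unfold skewPoly
  split_ifs with hn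
  · exact hdeg n
  · rw [hD _ (hmonic _), hdeg]
    have := Nat.not_even_iff_odd.1 hn
    have := this.pos
    omega

lemma polyForm_skewPoly_even (hint : ∀ j : ℕ, Integrable fun x => w x * x ^ j) (μ : ℝ[X] →ₗ[ℝ] ℝ)
    (hdeg : ∀ n, (h n).natDegree = n)
    (horth : ∀ n q, q.natDegree < n → μ (h n * q) = 0)
    (hform : ∀ p q, polyForm hint p (D q) = μ (p * q)) (i j : ℕ) :
    polyForm hint (skewPoly h D (2 * i)) (skewPoly h D (2 * j + 1)) =
      if i = j then μ (h (2 * i) * h (2 * i)) else 0 := by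
  rw [skewPoly_even, skewPoly_odd, hform]
  split_ifs with hij
  · rw [hij]
  · rcases lt_or_gt_of_ne hij with hlt | hlt
    · rw [mul_comm, horth _ _ (by rw [hdeg]; omega)]
    · rw [horth _ _ (by rw [hdeg]; omega)]

/-- For $i<j$ the value is $\mu(h_{2j}\cdot Dh_{2i})$, and $Dh_{2i}$ has degree $2i+1<2j$. The other
cases follow from skewness. -/
lemma polyForm_skewPoly_odd (hint : ∀ j : ℕ, Integrable fun x => w x * x ^ j) (μ : ℝ[X] →ₗ[ℝ] ℝ)
    (hmonic : ∀ n, (h n).Monic) (hdeg : ∀ n, (h n).natDegree = n)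
    (horth : ∀ n q, q.natDegree < n → μ (h n * q) = 0)
    (hD : ∀ p : ℝ[X], p.Monic → (D p).natDegree = p.natDegree + 1)
    (hform : ∀ p q, polyForm hint p (D q) = μ (p * q)) (i j : ℕ) :
    polyForm hint (skewPoly h D (2 * i + 1)) (skewPoly h D (2 * j + 1)) = 0 := by
  have hlt : ∀ i j, i < j →
      polyForm hint (skewPoly h D (2 * i + 1)) (skewPoly h D (2 * j + 1)) = 0 := by
    intro i j hij
    rw [skewPoly_odd, skewPoly_odd, hform, mul_comm, horth _ _ (by
      rw [hD _ (hmonic _), hdeg]; omega)]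
  rcases lt_trichotomy i j with hij | rfl | hij
  · exact hlt i j hij
  · have := polyForm_skew hint (skewPoly h D (2 * i + 1)) (skewPoly h D (2 * i + 1))
    linarith
  · rw [polyForm_skew, hlt j i hij, neg_zero]

lemma pfaffian_momentMatrix_eq_prod (hint : ∀ j : ℕ, Integrable fun x => w x * x ^ j)
    (μ : ℝ[X] →ₗ[ℝ] ℝ) (hmonic : ∀ n, (h n).Monic) (hdeg : ∀ n, (h n).natDegree = n)
    (horth : ∀ n q, q.natDegree < n → μ (h n * q) = 0)
    (hDm : ∀ p : ℝ[X], p.Monic → (D p).Monic)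
    (hD : ∀ p : ℝ[X], p.Monic → (D p).natDegree = p.natDegree + 1)
    (hform : ∀ p q, polyForm hint p (D q) = μ (p * q)) (s : ℝ) {m N : ℕ} (hN : N = 2 * m) :
    pfaffian (momentMatrix (fun x => (w x : ℂ) * markFactor s 1 x) N) =
      ((∏ i ∈ Finset.range m, μ (h (2 * i) * h (2 * i)) : ℝ) : ℂ) := by
  have hR := natDegree_skewPoly hmonic hdeg hD
  have hconj := pfaffian_conj (N := N) ⟨m, by omega⟩
    (momentMatrix (fun x => (w x : ℂ) * markFactor s 1 x) N) (coeffMatrix (skewPoly h D) N)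
  rw [det_coeffMatrix (monic_skewPoly hmonic hDm) hR, one_mul] at hconj
  rw [← hconj, pfaffian_eq_prod (m := m) (by omega) _
    (fun i => ((μ (h (2 * i) * h (2 * i)) : ℝ) : ℂ)), Complex.ofReal_prod]
  · intro j k
    rw [coeffMatrix_conj hint s N hR, coeffMatrix_conj hint s N hR, polyForm_skew,
      Complex.ofReal_neg]
  · rintro ⟨j, _⟩ ⟨k, _⟩ ⟨a, rfl⟩ ⟨b, rfl⟩
    rw [coeffMatrix_conj hint s N hR, polyForm_skewPoly_odd hint μ hmonic hdeg horth hD hform,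
      Complex.ofReal_zero]
  · intro i j hi hj
    rw [coeffMatrix_conj hint s N hR, polyForm_skewPoly_even hint μ hdeg horth hform]
    split_ifs <;> simp

/-- Here `hν`, the vanishing of the total integral of $w\,Dq$, removes the odd-indexed border
entries, leaving $\int w\,h_{2m}$ as the last factor. -/
lemma pfaffian_bordered_momentMatrix_eq_prod (hint : ∀ j : ℕ, Integrable fun x => w x * x ^ j)
    (μ : ℝ[X] →ₗ[ℝ] ℝ) (hmonic : ∀ n, (h n).Monic) (hdeg : ∀ n, (h n).natDegree = n)
    (horth : ∀ n q, q.natDegree < n → μ (h n * q) = 0)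
    (hDm : ∀ p : ℝ[X], p.Monic → (D p).Monic)
    (hD : ∀ p : ℝ[X], p.Monic → (D p).natDegree = p.natDegree + 1)
    (hform : ∀ p q, polyForm hint p (D q) = μ (p * q))
    (hν : ∀ q, polyIntegral hint (D q) = 0) (s : ℝ) {m N : ℕ} (hN : N = 2 * m + 1) :
    pfaffian (bordered (momentMatrix (fun x => (w x : ℂ) * markFactor s 1 x) N)
      (momentVec (fun x => (w x : ℂ) * markFactor s 1 x) N)) =
      (((∏ i ∈ Finset.range m, μ (h (2 * i) * h (2 * i))) * polyIntegral hint (h (2 * m)) : ℝ) :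
        ℂ) := by
  have hR := natDegree_skewPoly hmonic hdeg hD
  have hconj := pfaffian_bordered_conj (N := N) ⟨m, by omega⟩
    (momentMatrix (fun x => (w x : ℂ) * markFactor s 1 x) N) (coeffMatrix (skewPoly h D) N)
    (momentVec (fun x => (w x : ℂ) * markFactor s 1 x) N)
  rw [det_coeffMatrix (monic_skewPoly hmonic hDm) hR, one_mul] at hconj
  rw [← hconj, pfaffian_bordered_eq_prod (m := m) hN _ _
    (fun i => ((μ (h (2 * i) * h (2 * i)) : ℝ) : ℂ)), Complex.ofReal_mul, Complex.ofReal_prod,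
    coeffMatrix_mulVec hint s N hR, skewPoly_even]
  · intro j k
    rw [coeffMatrix_conj hint s N hR, coeffMatrix_conj hint s N hR, polyForm_skew,
      Complex.ofReal_neg]
  · rintro ⟨j, _⟩ ⟨k, _⟩ ⟨a, rfl⟩ ⟨b, rfl⟩
    rw [coeffMatrix_conj hint s N hR, polyForm_skewPoly_odd hint μ hmonic hdeg horth hD hform,
      Complex.ofReal_zero]
  · intro i j hi hj
    rw [coeffMatrix_conj hint s N hR, polyForm_skewPoly_even hint μ hdeg horth hform]
    split_ifs <;> simp
  · rintro ⟨j, _⟩ ⟨a, rfl⟩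
    rw [coeffMatrix_mulVec hint s N hR, skewPoly_odd, hν, Complex.ofReal_zero]

end Functionals

section

open Polynomial

/-! ## Integration by parts in the skew inner product -/

lemma integral_mul_sign {g : ℝ → ℝ} (hg : Integrable g) (x : ℝ) :
    ∫ y, g y * Real.sign (y - x) = 2 * (∫ y in Ioi x, g y) - ∫ y, g y := by
  rw [← integral_indicator measurableSet_Ioi, ← integral_const_mul,
    ← integral_sub ((hg.indicator measurableSet_Ioi).const_mul _) hg]
  refine integral_congr_ae ?_
  have hne : ∀ᵐ y : ℝ, y ≠ x := by simp [ae_iff]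
  filter_upwards [hne] with y hy
  rcases lt_or_gt_of_ne hy with h | h
  · rw [Real.sign_of_neg (sub_neg.2 h), indicator_of_notMem (by simpa using h.le)]
    ring
  · rw [Real.sign_of_pos (sub_pos.2 h), indicator_of_mem (by simpa using h)]
    ring

/-- When $\int wq=0$, the inner integral against ${\rm sgn}(y-x)$ is twice the tail of $wq$ beyond
$x$. The tail is needed only where $w\neq0$, which confines the Laguerre computation to $x>0$. -/
lemma polyForm_eq_of_tail {w F : ℝ → ℝ} (hint : ∀ j : ℕ, Integrable fun x => w x * x ^ j)
    (p q : ℝ[X]) (htail : ∀ x, w x ≠ 0 → ∫ y in Ioi x, w y * q.eval y = F x)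
    (hzero : polyIntegral hint q = 0) :
    polyForm hint p q = 2 * ∫ x, w x * p.eval x * F x := by
  rw [polyForm_apply]
  refine (integral_prod _ (integrable_mul_eval_sign hint p q)).trans ?_
  rw [← integral_const_mul]
  refine integral_congr_ae (Filter.Eventually.of_forall fun x => ?_)
  have h1 : ∫ y, (w x * p.eval x) * (w y * q.eval y) * Real.sign (y - x) =
      (w x * p.eval x) * (2 * ∫ y in Ioi x, w y * q.eval y) := by
    -- The vanishing total integral is inserted so that `integral_mul_sign` can be read backwards.
    rw [← sub_zero (2 * _), ← hzero, polyIntegral_apply,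
      ← integral_mul_sign (integrable_mul_eval hint q), ← integral_const_mul]
    simp only [mul_assoc]
  dsimp only
  rw [h1]
  by_cases hw : w x = 0
  · simp [hw]
  · rw [htail x hw]
    ring

/-! ## The Gaussian functional -/

section Gaussian

variable {c : ℝ}

/-- The Gaussian weight with parameter `c`. -/
def gaussW (c x : ℝ) : ℝ := Real.exp (-(c * x ^ 2))

lemma gaussW_pos (c x : ℝ) : 0 < gaussW c x := Real.exp_pos _

lemma integrable_gaussW_mul_pow (hc : 0 < c) (j : ℕ) :
    Integrable fun x => gaussW c x * x ^ j := by
  refine (integrable_rpow_mul_exp_neg_mul_sq hc (s := j) (by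
    linarith [(Nat.cast_nonneg j : (0 : ℝ) ≤ j)])).congr
    (Filter.Eventually.of_forall fun x => ?_)
  simp only [gaussW, Real.rpow_natCast, neg_mul]
  ring

lemma hasDerivAt_gaussW_mul_eval (c : ℝ) (r : ℝ[X]) (x : ℝ) :
    HasDerivAt (fun x => -(gaussW c x * r.eval x))
      (gaussW c x * (C (2 * c) * X * r - derivative r).eval x) x := by
  have h1 : HasDerivAt (fun x => gaussW c x) (gaussW c x * (-(c * (2 * x)))) x := by
    have := (((hasDerivAt_pow 2 x).const_mul c).neg).exp
    simpa [gaussW] using this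
  refine (h1.mul (r.hasDerivAt x)).neg.congr_deriv ?_
  simp only [eval_sub, eval_mul, eval_C, eval_X]
  ring

lemma polyIntegral_gaussW_deriv (hc : 0 < c) (r : ℝ[X]) :
    polyIntegral (integrable_gaussW_mul_pow hc) (C (2 * c) * X * r - derivative r) = 0 :=
  integral_eq_zero_of_hasDerivAt_of_integrable (hasDerivAt_gaussW_mul_eval c r)
    (integrable_mul_eval (integrable_gaussW_mul_pow hc) _)
    (integrable_mul_eval (integrable_gaussW_mul_pow hc) r).neg

lemma integral_Ioi_gaussW_deriv (hc : 0 < c) (r : ℝ[X]) (x : ℝ) :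
    ∫ y in Ioi x, gaussW c y * (C (2 * c) * X * r - derivative r).eval y =
      gaussW c x * r.eval x := by
  have hi := integrable_gaussW_mul_pow hc
  rw [integral_Ioi_of_hasDerivAt_of_tendsto' (m := 0)
    (fun y _ => hasDerivAt_gaussW_mul_eval c r y) (integrable_mul_eval hi _).integrableOn]
  · ring
  · exact tendsto_zero_of_hasDerivAt_of_integrableOn_Ioi (a := x)
      (fun y _ => hasDerivAt_gaussW_mul_eval c r y) (integrable_mul_eval hi _).integrableOn
      (integrable_mul_eval hi r).neg.integrableOn

/-- Monic Hermite polynomials for the weight `e^{-x²}`. -/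
def monicHermite : ℕ → ℝ[X]
  | 0 => 1
  | n + 1 => X * monicHermite n - C (1 / 2) * derivative (monicHermite n)

lemma monic_X_mul_sub {p q : ℝ[X]} (hp : p.Monic) (hq : q.degree ≤ p.degree) :
    (X * p - q).Monic ∧ (X * p - q).natDegree = p.natDegree + 1 := by
  have hlt : q.degree < (X * p).degree := by
    refine hq.trans_lt ?_
    rw [mul_comm, degree_mul_X, degree_eq_natDegree hp.ne_zero]
    exact_mod_cast Nat.lt_succ_self _
  have hX : (X * p).Monic := monic_X.mul hp
  refine ⟨hX.sub_of_left hlt, ?_⟩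
  rw [natDegree_sub_eq_left_of_natDegree_lt, mul_comm, natDegree_mul_X hp.ne_zero]
  by_cases hq0 : q = 0
  · rw [hq0, natDegree_zero, mul_comm, natDegree_mul_X hp.ne_zero]
    omega
  · exact natDegree_lt_natDegree hq0 hlt

lemma degree_C_mul_le (a : ℝ) (p : ℝ[X]) : (C a * p).degree ≤ p.degree := by
  rw [← smul_eq_C_mul]
  exact degree_smul_le a p

lemma degree_C_mul_derivative_le (a : ℝ) (p : ℝ[X]) :
    (C a * derivative p).degree ≤ p.degree :=
  (degree_C_mul_le a _).trans (degree_derivative_le)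

lemma monicHermite_monic (n : ℕ) : (monicHermite n).Monic := by
  induction n with
  | zero => exact monic_one
  | succ n ih => exact (monic_X_mul_sub ih (degree_C_mul_derivative_le _ _)).1

lemma natDegree_monicHermite (n : ℕ) : (monicHermite n).natDegree = n := by
  induction n with
  | zero => exact natDegree_one
  | succ n ih =>
    rw [monicHermite, (monic_X_mul_sub (monicHermite_monic n)
      (degree_C_mul_derivative_le _ _)).2, ih]

lemma derivative_monicHermite (n : ℕ) :
    derivative (monicHermite (n + 1)) = C ((n : ℝ) + 1) * monicHermite n := by
  induction n with
  | zero => simp [monicHermite]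
  | succ n ih =>
    have h2 : monicHermite (n + 1) =
        X * monicHermite n - C (1 / 2) * derivative (monicHermite n) := rfl
    rw [monicHermite, derivative_sub, derivative_mul, derivative_C_mul, ih, derivative_C_mul,
      derivative_X, h2]
    push_cast
    simp only [C_add, C_1]
    ring

/-- The Gaussian functional. -/
def gaussInt (hc : 0 < c) : ℝ[X] →ₗ[ℝ] ℝ := polyIntegral (integrable_gaussW_mul_pow hc)

lemma map_C_mul (μ : ℝ[X] →ₗ[ℝ] ℝ) (a : ℝ) (p : ℝ[X]) : μ (C a * p) = a * μ p := by
  rw [← smul_eq_C_mul, map_smul, smul_eq_mul]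

/-- The recursion defining `monicHermite` is a Rodrigues formula,
$e^{-x^2}h_{n+1}=-\tfrac12(e^{-x^2}h_n)'$, and this is one integration by parts. Iterated, it gives
orthogonality and the norms. -/
lemma gaussInt_one_monicHermite_mul (n : ℕ) (q : ℝ[X]) :
    gaussInt one_pos (monicHermite (n + 1) * q) =
      1 / 2 * gaussInt one_pos (monicHermite n * derivative q) := by
  have h := polyIntegral_gaussW_deriv (c := 1) one_pos (monicHermite n * q)
  change gaussInt one_pos _ = 0 at h
  have h2 : monicHermite (n + 1) * q = C (1 / 2) * (C (2 * 1) * X * (monicHermite n * q) -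
      derivative (monicHermite n * q)) + C (1 / 2) * (monicHermite n * derivative q) := by
    rw [monicHermite, derivative_mul]
    have : (C (1 / 2) * C (2 * 1) : ℝ[X]) = 1 := by rw [← C_mul]; norm_num
    linear_combination (-(X * (monicHermite n * q))) * this
  rw [h2, map_add, map_C_mul, map_C_mul, h]
  ring

lemma natDegree_derivative_lt_of_lt {q : ℝ[X]} {n : ℕ} (hq : q.natDegree < n + 1) :
    derivative q = 0 ∨ (derivative q).natDegree < n := by
  rcases Nat.eq_zero_or_pos q.natDegree with h | h
  · exact Or.inl (derivative_of_natDegree_zero h)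
  · exact Or.inr ((natDegree_derivative_lt h.ne').trans_le (by omega))

lemma gaussInt_one_monicHermite_orthogonal (n : ℕ) (q : ℝ[X]) (hq : q.natDegree < n) :
    gaussInt one_pos (monicHermite n * q) = 0 := by
  induction n generalizing q with
  | zero => omega
  | succ n ih =>
    rw [gaussInt_one_monicHermite_mul]
    rcases natDegree_derivative_lt_of_lt hq with h | h
    · simp [h]
    · rw [ih _ h, mul_zero]

lemma gaussInt_one (hc : 0 < c) : gaussInt hc 1 = √(Real.pi / c) := by
  rw [← integral_gaussian]
  simp [gaussInt, polyIntegral_apply, gaussW]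

lemma gaussInt_one_monicHermite_sq (n : ℕ) :
    gaussInt one_pos (monicHermite n * monicHermite n) =
      n.factorial * (1 / 2) ^ n * √Real.pi := by
  induction n with
  | zero => simp [monicHermite, gaussInt_one]
  | succ n ih =>
    rw [gaussInt_one_monicHermite_mul, derivative_monicHermite, mul_left_comm, map_C_mul, ih,
      Nat.factorial_succ]
    push_cast
    ring

/-- Here the weight is $e^{-x^2/2}$, not the weight of orthogonality. Writing
$h_{n+2}=(xh_{n+1}-h_{n+1}')+\tfrac12h_{n+1}'$, the bracket times the weight is a total derivative,
and $h_{n+1}'=(n+1)h_n$. -/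
lemma gaussInt_half_monicHermite (n : ℕ) :
    gaussInt one_half_pos (monicHermite (n + 2)) =
      ((n : ℝ) + 1) / 2 * gaussInt one_half_pos (monicHermite n) := by
  have h := polyIntegral_gaussW_deriv (c := 1 / 2) one_half_pos (monicHermite (n + 1))
  change gaussInt one_half_pos _ = 0 at h
  have h2 : monicHermite (n + 2) = (C (2 * (1 / 2)) * X * monicHermite (n + 1) -
      derivative (monicHermite (n + 1))) + C ((1 / 2) * ((n : ℝ) + 1)) * monicHermite n := by
    have h3 : (C (2 * (1 / 2)) : ℝ[X]) = 1 := by norm_num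
    have h4 : (2 * C (1 / 2) : ℝ[X]) = 1 := by
      rw [show (2 : ℝ[X]) = C 2 from rfl, ← C_mul]; norm_num
    rw [monicHermite, derivative_monicHermite, h3, C_mul]
    linear_combination (-(C ((n : ℝ) + 1) * monicHermite n)) * h4
  rw [h2, map_add, h, map_C_mul]
  ring

lemma gaussInt_half_monicHermite_two_mul (m : ℕ) :
    gaussInt one_half_pos (monicHermite (2 * m)) = √2 * Real.Gamma ((m : ℝ) + 1 / 2) := by
  induction m with
  | zero =>
    simp only [monicHermite, gaussInt_one, Nat.cast_zero, zero_add,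
      Real.Gamma_one_half_eq]
    rw [← Real.sqrt_mul (by norm_num)]
    congr 1
    ring
  | succ m ih =>
    rw [show 2 * (m + 1) = 2 * m + 2 by ring, gaussInt_half_monicHermite, ih,
      show ((m + 1 : ℕ) : ℝ) + 1 / 2 = ((m : ℝ) + 1 / 2) + 1 by push_cast; ring,
      Real.Gamma_add_one (by positivity)]
    push_cast
    ring

end Gaussian

/-! ## The Laguerre functional -/

section Laguerre

variable {b c : ℝ}

/-- The weight `x^b e^{-cx}` on the half line. -/
def lagW (b c x : ℝ) : ℝ := if 0 < x then x ^ b * Real.exp (-(c * x)) else 0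

lemma lagW_of_pos {x : ℝ} (hx : 0 < x) : lagW b c x = x ^ b * Real.exp (-(c * x)) := if_pos hx

lemma lagW_of_nonpos {x : ℝ} (hx : x ≤ 0) : lagW b c x = 0 := if_neg hx.not_gt

lemma lagW_nonneg (b c x : ℝ) : 0 ≤ lagW b c x := by
  unfold lagW
  split_ifs with h
  · positivity
  · exact le_rfl

lemma lagW_mul_pow (b c : ℝ) (j : ℕ) (x : ℝ) : lagW b c x * x ^ j = lagW (b + j) c x := by
  rcases lt_or_ge 0 x with hx | hx
  · rw [lagW_of_pos hx, lagW_of_pos hx, Real.rpow_add hx, Real.rpow_natCast]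
    ring
  · rw [lagW_of_nonpos hx, lagW_of_nonpos hx, zero_mul]

lemma lagW_add_one (b c x : ℝ) : lagW (b + 1) c x = lagW b c x * x := by
  have := lagW_mul_pow b c 1 x
  rw [pow_one] at this
  rw [this, Nat.cast_one]

lemma lagW_eq_indicator (b c : ℝ) :
    lagW b c = (Ioi 0).indicator fun x => x ^ b * Real.exp (-(c * x)) := by
  ext x
  simp [lagW, indicator_apply]

lemma integrable_lagW (hb : -1 < b) (hc : 0 < c) : Integrable (lagW b c) := by
  rw [lagW_eq_indicator, integrable_indicator_iff measurableSet_Ioi]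
  simpa using integrableOn_rpow_mul_exp_neg_mul_rpow hb one_pos hc

lemma integrable_lagW_mul_pow (hb : -1 < b) (hc : 0 < c) (j : ℕ) :
    Integrable fun x => lagW b c x * x ^ j := by
  simp only [lagW_mul_pow]
  exact integrable_lagW (by linarith [(Nat.cast_nonneg j : (0 : ℝ) ≤ j)]) hc

lemma integral_lagW (hb : -1 < b) (hc : 0 < c) :
    ∫ x, lagW b c x = (1 / c) ^ (b + 1) * Real.Gamma (b + 1) := by
  rw [lagW_eq_indicator, integral_indicator measurableSet_Ioi,
    ← Real.integral_rpow_mul_exp_neg_mul_Ioi (by linarith) hc, add_sub_cancel_right]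

/-- The functional `p ↦ ∫_0^∞ x^b e^{-cx} p(x) dx`. -/
def lagInt (hb : -1 < b) (hc : 0 < c) : ℝ[X] →ₗ[ℝ] ℝ :=
  polyIntegral (integrable_lagW_mul_pow hb hc)

lemma lagInt_one (hb : -1 < b) (hc : 0 < c) :
    lagInt hb hc 1 = (1 / c) ^ (b + 1) * Real.Gamma (b + 1) := by
  rw [← integral_lagW hb hc]
  simp [lagInt, polyIntegral_apply]

lemma lagInt_X_mul (hb : -1 < b) (hb' : -1 < b + 1) (hc : 0 < c) (p : ℝ[X]) :
    lagInt hb hc (X * p) = lagInt hb' hc p := by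
  simp only [lagInt, polyIntegral_apply, lagW_add_one, eval_mul, eval_X, mul_assoc]

lemma hasDerivAt_lagW_mul_eval (b c : ℝ) (r : ℝ[X]) {x : ℝ} (hx : 0 < x) :
    HasDerivAt (fun x => -(x ^ (b + 1) * Real.exp (-(c * x)) * r.eval x))
      (lagW b c x * ((C c * X - C (b + 1)) * r - X * derivative r).eval x) x := by
  have h1 : HasDerivAt (fun x : ℝ => x ^ (b + 1)) ((b + 1) * x ^ b) x := by
    simpa using Real.hasDerivAt_rpow_const (p := b + 1) (Or.inl hx.ne')
  have h2 : HasDerivAt (fun x : ℝ => Real.exp (-(c * x))) (Real.exp (-(c * x)) * (-c)) x := by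
    simpa using (((hasDerivAt_id x).const_mul c).neg).exp
  refine ((h1.mul h2).mul (r.hasDerivAt x)).neg.congr_deriv ?_
  simp only [Pi.mul_apply, lagW_of_pos hx, Real.rpow_add hx, Real.rpow_one, eval_sub, eval_mul,
    eval_C, eval_X]
  ring

lemma integral_Ioi_lagW_deriv (hb : -1 < b) (hc : 0 < c) (r : ℝ[X]) {x : ℝ} (hx : 0 ≤ x) :
    ∫ y in Ioi x, lagW b c y * ((C c * X - C (b + 1)) * r - X * derivative r).eval y =
      x ^ (b + 1) * Real.exp (-(c * x)) * r.eval x := by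
  have hi := integrable_lagW_mul_pow hb hc
  have hi' := integrable_lagW_mul_pow (b := b + 1) (by linarith) hc
  have hder : ∀ y ∈ Ioi x, HasDerivAt (fun x => -(x ^ (b + 1) * Real.exp (-(c * x)) * r.eval x))
      (lagW b c y * ((C c * X - C (b + 1)) * r - X * derivative r).eval y) y :=
    fun y hy => hasDerivAt_lagW_mul_eval b c r (hx.trans_lt hy)
  rw [integral_Ioi_of_hasDerivAt_of_tendsto (m := 0) ?_ hder
    (integrable_mul_eval hi _).integrableOn]
  · ring
  · refine tendsto_zero_of_hasDerivAt_of_integrableOn_Ioi hder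
      (integrable_mul_eval hi _).integrableOn ?_
    refine ((integrable_mul_eval hi' r).neg.integrableOn (s := Ioi x)).congr_fun ?_
      measurableSet_Ioi
    intro y hy
    simp [lagW_of_pos (hx.trans_lt hy)]
  -- The derivative formula holds only to the right of $x$; at $x=0$ the primitive is still
  -- continuous because $b+1>0$.
  · have h1 : ContinuousAt (fun x : ℝ => x ^ (b + 1)) x :=
      Real.continuousAt_rpow_const _ _ (Or.inr (by linarith))
    have h2 : ContinuousAt (fun x : ℝ => Real.exp (-(c * x))) x := by fun_prop
    exact ((h1.mul h2).mul r.continuousAt).neg.continuousWithinAt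

lemma integral_lagW_mul_eq (b c : ℝ) (f : ℝ → ℝ) :
    ∫ x, lagW b c x * f x = ∫ x in Ioi 0, lagW b c x * f x := by
  rw [← integral_indicator measurableSet_Ioi]
  refine integral_congr_ae (Filter.Eventually.of_forall fun x => ?_)
  by_cases hx : 0 < x
  · simp [hx]
  · simp [hx, lagW_of_nonpos (not_lt.1 hx)]

lemma lagInt_deriv (hb : -1 < b) (hc : 0 < c) (r : ℝ[X]) :
    lagInt hb hc ((C c * X - C (b + 1)) * r - X * derivative r) = 0 := by
  rw [lagInt, polyIntegral_apply, integral_lagW_mul_eq, integral_Ioi_lagW_deriv hb hc r le_rfl,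
    Real.zero_rpow (by linarith)]
  simp

/-- Monic Laguerre polynomials for the weight `x^b e^{-x}`. -/
def monicLaguerre : ℝ → ℕ → ℝ[X]
  | _, 0 => 1
  | b, n + 1 => X * monicLaguerre (b + 1) n -
      (C (b + 1) * monicLaguerre (b + 1) n + X * derivative (monicLaguerre (b + 1) n))

lemma degree_X_mul_derivative_le (p : ℝ[X]) : (X * derivative p).degree ≤ p.degree := by
  by_cases hp : p.natDegree = 0
  · simp [derivative_of_natDegree_zero hp]
  · have hp0 : p ≠ 0 := fun h => hp (by simp [h])
    have h1 : (X * derivative p).natDegree ≤ p.natDegree :=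
      (natDegree_mul_le).trans (by
        rw [natDegree_X]
        have := natDegree_derivative_lt hp
        omega)
    rw [degree_eq_natDegree hp0]
    exact natDegree_le_iff_degree_le.1 h1

lemma degree_C_mul_add_C_mul_X_mul_derivative_le (a d : ℝ) (p : ℝ[X]) :
    (C a * p + C d * (X * derivative p)).degree ≤ p.degree :=
  (degree_add_le _ _).trans (max_le (degree_C_mul_le _ _)
    ((degree_C_mul_le _ _).trans (degree_X_mul_derivative_le p)))

lemma monicLaguerre_succ (b : ℝ) (n : ℕ) : monicLaguerre b (n + 1) =
    X * monicLaguerre (b + 1) n - (C (b + 1) * monicLaguerre (b + 1) n +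
      C 1 * (X * derivative (monicLaguerre (b + 1) n))) := by
  rw [monicLaguerre, C_1, one_mul]

lemma monicLaguerre_monic (b : ℝ) (n : ℕ) : (monicLaguerre b n).Monic := by
  induction n generalizing b with
  | zero => exact monic_one
  | succ n ih =>
    rw [monicLaguerre_succ]
    exact (monic_X_mul_sub (ih _) (degree_C_mul_add_C_mul_X_mul_derivative_le _ _ _)).1

lemma natDegree_monicLaguerre (b : ℝ) (n : ℕ) : (monicLaguerre b n).natDegree = n := by
  induction n generalizing b with
  | zero => exact natDegree_one
  | succ n ih =>
    rw [monicLaguerre_succ, (monic_X_mul_sub (monicLaguerre_monic _ _)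
      (degree_C_mul_add_C_mul_X_mul_derivative_le _ _ _)).2, ih]

lemma derivative_monicLaguerre (b : ℝ) (n : ℕ) :
    derivative (monicLaguerre b (n + 1)) = C ((n : ℝ) + 1) * monicLaguerre (b + 1) n := by
  induction n generalizing b with
  | zero => simp [monicLaguerre]
  | succ n ih =>
    rw [monicLaguerre, derivative_sub, derivative_add, derivative_mul, derivative_C_mul,
      derivative_mul, ih, derivative_C_mul, derivative_X]
    rw [show monicLaguerre (b + 1) (n + 1) = X * monicLaguerre (b + 1 + 1) n -
      (C (b + 1 + 1) * monicLaguerre (b + 1 + 1) n +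
        X * derivative (monicLaguerre (b + 1 + 1) n)) from rfl]
    push_cast
    simp only [C_add, C_1]
    ring

/-- Rodrigues with a shift of parameter: $x^be^{-x}L^{(b)}_{n+1}=-(x^{b+1}e^{-x}L^{(b+1)}_n)'$ for
the monic polynomials. The induction therefore has to run over all $b>-1$. -/
lemma lagInt_monicLaguerre_mul (hb : -1 < b) (hb' : -1 < b + 1) (n : ℕ) (q : ℝ[X]) :
    lagInt hb one_pos (monicLaguerre b (n + 1) * q) =
      lagInt hb' one_pos (monicLaguerre (b + 1) n * derivative q) := by
  have h := lagInt_deriv hb one_pos (monicLaguerre (b + 1) n * q)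
  have h2 : monicLaguerre b (n + 1) * q =
      ((C 1 * X - C (b + 1)) * (monicLaguerre (b + 1) n * q) -
        X * derivative (monicLaguerre (b + 1) n * q)) +
        X * (monicLaguerre (b + 1) n * derivative q) := by
    rw [monicLaguerre, derivative_mul, C_1]
    ring
  rw [h2, map_add, h, lagInt_X_mul hb hb', zero_add]

lemma lagInt_monicLaguerre_orthogonal (hb : -1 < b) (n : ℕ) (q : ℝ[X]) (hq : q.natDegree < n) :
    lagInt hb one_pos (monicLaguerre b n * q) = 0 := by
  induction n generalizing b q with
  | zero => omega
  | succ n ih =>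
    have hb' : -1 < b + 1 := by linarith
    rw [lagInt_monicLaguerre_mul hb hb']
    rcases natDegree_derivative_lt_of_lt hq with h | h
    · simp [h]
    · exact ih hb' _ h

lemma lagInt_monicLaguerre_sq (hb : -1 < b) (n : ℕ) :
    lagInt hb one_pos (monicLaguerre b n * monicLaguerre b n) =
      n.factorial * Real.Gamma (b + n + 1) := by
  induction n generalizing b with
  | zero => simp [monicLaguerre, lagInt_one]
  | succ n ih =>
    have hb' : -1 < b + 1 := by linarith
    rw [lagInt_monicLaguerre_mul hb hb', derivative_monicLaguerre, mul_left_comm, map_C_mul, ih,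
      Nat.factorial_succ]
    push_cast
    rw [show b + 1 + (n : ℝ) + 1 = b + ((n : ℝ) + 1) + 1 by ring]
    ring

/-- With $p=L^{(2b+2)}_{n+1}$ (monic), $L^{(2b+1)}_{n+2}=2\{(\tfrac x2-b-1)p-xp'\}+xp'$. The brace
integrates to zero against $x^be^{-x/2}$, and in $xp'=(n+1)\,x\,L^{(2b+3)}_n$ the factor $x$ raises
$b$ to $b+1$, so the relation $2b+1$ between the parameters persists. -/
lemma lagInt_half_monicLaguerre (hb : -1 < b) (hb' : -1 < b + 1) (n : ℕ) :
    lagInt hb one_half_pos (monicLaguerre (2 * b + 1) (n + 2)) =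
      ((n : ℝ) + 1) * lagInt hb' one_half_pos (monicLaguerre (2 * (b + 1) + 1) n) := by
  have h := lagInt_deriv hb one_half_pos (monicLaguerre (2 * b + 1 + 1) (n + 1))
  have h2 : monicLaguerre (2 * b + 1) (n + 2) =
      C 2 * ((C (1 / 2) * X - C (b + 1)) * monicLaguerre (2 * b + 1 + 1) (n + 1) -
        X * derivative (monicLaguerre (2 * b + 1 + 1) (n + 1))) +
        X * derivative (monicLaguerre (2 * b + 1 + 1) (n + 1)) := by
    have h3 : (C 2 * C (1 / 2) : ℝ[X]) = 1 := by rw [← C_mul]; norm_num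
    have h4 : (C (2 * b + 1 + 1) : ℝ[X]) = C 2 * C (b + 1) := by rw [← C_mul]; congr 1; ring
    rw [monicLaguerre, h4, show (C 2 : ℝ[X]) = 2 from rfl] at *
    linear_combination (-(X * monicLaguerre (2 * b + 1 + 1) (n + 1))) * h3
  rw [h2, map_add, map_C_mul, h, lagInt_X_mul hb hb', derivative_monicLaguerre, map_C_mul,
    show 2 * b + 1 + 1 + 1 = 2 * (b + 1) + 1 by ring]
  ring

lemma lagInt_half_monicLaguerre_two_mul (hb : -1 < b) (m : ℕ) :
    lagInt hb one_half_pos (monicLaguerre (2 * b + 1) (2 * m)) =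
      2 ^ (b + 2 * m + 1) * Real.Gamma ((m : ℝ) + 1 / 2) * Real.Gamma (b + m + 1) /
        √Real.pi := by
  induction m generalizing b with
  | zero =>
    simp only [mul_zero, monicLaguerre, lagInt_one, Nat.cast_zero, zero_add, add_zero,
      Real.Gamma_one_half_eq]
    have : √Real.pi ≠ 0 := (Real.sqrt_pos.2 Real.pi_pos).ne'
    field_simp
  | succ m ih =>
    have hb' : -1 < b + 1 := by linarith
    rw [show 2 * (m + 1) = 2 * m + 2 by ring, lagInt_half_monicLaguerre hb hb', ih,
      show ((m + 1 : ℕ) : ℝ) + 1 / 2 = ((m : ℝ) + 1 / 2) + 1 by push_cast; ring,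
      Real.Gamma_add_one (s := (m : ℝ) + 1 / 2) (by positivity),
      show b + 2 * ((m + 1 : ℕ) : ℝ) + 1 = (b + 1 + 2 * m + 1) + 1 by push_cast; ring,
      Real.rpow_add_one (by norm_num) (b + 1 + 2 * m + 1),
      show b + ((m + 1 : ℕ) : ℝ) + 1 = b + 1 + m + 1 by push_cast; ring]
    push_cast
    ring

end Laguerre

end

/-! ## Normalisation constants -/

section Normalisation

open Polynomial

lemma gaussW_half_mul_self (x : ℝ) : gaussW (1 / 2) x * gaussW (1 / 2) x = gaussW 1 x := by
  rw [gaussW, gaussW, ← Real.exp_add]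
  congr 1
  ring

lemma gauss_deriv_eq (q : ℝ[X]) :
    X * q - derivative q = C (2 * (1 / 2)) * X * q - derivative q := by
  rw [show (C (2 * (1 / 2)) : ℝ[X]) = 1 by norm_num, one_mul]

lemma polyForm_gaussW (p q : ℝ[X]) :
    polyForm (integrable_gaussW_mul_pow (c := 1 / 2) one_half_pos) p (X * q - derivative q) =
      ((2 : ℝ) • gaussInt one_pos) (p * q) := by
  rw [gauss_deriv_eq, polyForm_eq_of_tail (F := fun x => gaussW (1 / 2) x * q.eval x) _ _ _
    (fun x _ => integral_Ioi_gaussW_deriv one_half_pos q x)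
    (polyIntegral_gaussW_deriv one_half_pos q), LinearMap.smul_apply, smul_eq_mul, gaussInt,
    polyIntegral_apply]
  congr 2
  ext x
  rw [← gaussW_half_mul_self, eval_mul]
  ring

lemma prod_range_two_mul (f : ℕ → ℝ) (m : ℕ) :
    ∏ j ∈ Finset.range (2 * m), f j = ∏ i ∈ Finset.range m, f (2 * i) * f (2 * i + 1) := by
  induction m with
  | zero => simp
  | succ m ih =>
    rw [show 2 * (m + 1) = 2 * m + 1 + 1 by ring, Finset.prod_range_succ, Finset.prod_range_succ,
      ih, Finset.prod_range_succ]
    ring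

/-- Duplication formula at $i+\tfrac12$; the right side is the squared norm of the monic Hermite
polynomial of degree $2i$. -/
lemma Gamma_half_mul_Gamma_half (i : ℕ) :
    Real.Gamma (((2 * i : ℕ) + 1 : ℝ) / 2) * Real.Gamma (((2 * i + 1 : ℕ) + 1 : ℝ) / 2) =
      (2 * i).factorial * (1 / 2) ^ (2 * i) * √Real.pi := by
  have h := Real.Gamma_mul_Gamma_add_half ((i : ℝ) + 1 / 2)
  rw [show 2 * ((i : ℝ) + 1 / 2) = ((2 * i : ℕ) : ℝ) + 1 by push_cast; ring,
    Real.Gamma_nat_eq_factorial, show 1 - (((2 * i : ℕ) : ℝ) + 1) = -((2 * i : ℕ) : ℝ) by ring,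
    Real.rpow_neg two_pos.le, Real.rpow_natCast] at h
  rw [show ((2 * i : ℕ) + 1 : ℝ) / 2 = (i : ℝ) + 1 / 2 by push_cast; ring,
    show ((2 * i + 1 : ℕ) + 1 : ℝ) / 2 = (i : ℝ) + 1 / 2 + 1 / 2 by push_cast; ring, h,
    one_div, inv_pow]

/-- The normalisation of the Gaussian Pfaffian. -/
def normG (N : ℕ) : ℝ := ∏ j ∈ Finset.range N, √2 * Real.Gamma (((j : ℕ) + 1 : ℝ) / 2)

lemma normG_two_mul (m : ℕ) : normG (2 * m) = ∏ i ∈ Finset.range m,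
    ((2 : ℝ) • gaussInt one_pos) (monicHermite (2 * i) * monicHermite (2 * i)) := by
  rw [normG, prod_range_two_mul]
  refine Finset.prod_congr rfl fun i _ => ?_
  rw [LinearMap.smul_apply, smul_eq_mul, gaussInt_one_monicHermite_sq,
    ← Gamma_half_mul_Gamma_half, mul_mul_mul_comm, Real.mul_self_sqrt two_pos.le]

lemma monic_gauss_deriv {p : ℝ[X]} (hp : p.Monic) : (X * p - derivative p).Monic ∧
    (X * p - derivative p).natDegree = p.natDegree + 1 :=
  monic_X_mul_sub hp degree_derivative_le

lemma monicHermite_orthogonal_smul (n : ℕ) (q : ℝ[X]) (hq : q.natDegree < n) :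
    ((2 : ℝ) • gaussInt one_pos) (monicHermite n * q) = 0 := by
  rw [LinearMap.smul_apply, gaussInt_one_monicHermite_orthogonal n q hq, smul_zero]

lemma pfaffian_gaussW_of_even {N : ℕ} (hN : Even N) (s : ℝ) :
    pfaffian (momentMatrix (fun x => (gaussW (1 / 2) x : ℂ) * markFactor s 1 x) N) = normG N := by
  obtain ⟨m, rfl⟩ := even_iff_two_dvd.1 hN
  rw [pfaffian_momentMatrix_eq_prod (integrable_gaussW_mul_pow one_half_pos)
    ((2 : ℝ) • gaussInt one_pos) monicHermite_monic natDegree_monicHermite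
    monicHermite_orthogonal_smul (fun p hp => (monic_gauss_deriv hp).1)
    (fun p hp => (monic_gauss_deriv hp).2) polyForm_gaussW s rfl, normG_two_mul]

lemma pfaffian_gaussW_of_odd {N : ℕ} (hN : Odd N) (s : ℝ) :
    pfaffian (bordered (momentMatrix (fun x => (gaussW (1 / 2) x : ℂ) * markFactor s 1 x) N)
      (momentVec (fun x => (gaussW (1 / 2) x : ℂ) * markFactor s 1 x) N)) = normG N := by
  obtain ⟨m, rfl⟩ := hN
  rw [pfaffian_bordered_momentMatrix_eq_prod (integrable_gaussW_mul_pow one_half_pos)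
    ((2 : ℝ) • gaussInt one_pos) monicHermite_monic natDegree_monicHermite
    monicHermite_orthogonal_smul (fun p hp => (monic_gauss_deriv hp).1)
    (fun p hp => (monic_gauss_deriv hp).2) polyForm_gaussW
    (fun q => by rw [gauss_deriv_eq]; exact polyIntegral_gaussW_deriv one_half_pos q) s rfl,
    ← normG_two_mul, normG, normG, Finset.prod_range_succ]
  have := gaussInt_half_monicHermite_two_mul m
  rw [gaussInt] at this
  rw [this, show ((2 * m : ℕ) + 1 : ℝ) / 2 = (m : ℝ) + 1 / 2 by push_cast; ring]

variable {a : ℝ}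

/-- The differential operator attached to the Laguerre weight. -/
def lagD (a : ℝ) (q : ℝ[X]) : ℝ[X] := X * q - (C (2 * (a + 1)) * q + C 2 * (X * derivative q))

/-- Shows that $x^ae^{-x/2}\,Dq=-(2x^{a+1}e^{-x/2}q)'$. -/
lemma lagD_eq (a : ℝ) (q : ℝ[X]) :
    lagD a q = (C (1 / 2) * X - C (a + 1)) * (C 2 * q) - X * derivative (C 2 * q) := by
  have h3 : (C 2 * C (1 / 2) : ℝ[X]) = 1 := by rw [← C_mul]; norm_num
  rw [lagD, derivative_C_mul, C_mul]
  linear_combination (-(X * q)) * h3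

lemma monic_lagD {p : ℝ[X]} (hp : p.Monic) : (lagD a p).Monic ∧
    (lagD a p).natDegree = p.natDegree + 1 :=
  monic_X_mul_sub hp (degree_C_mul_add_C_mul_X_mul_derivative_le _ _ _)

lemma neg_one_lt_two_mul_add_one (ha : -1 < a) : -1 < 2 * a + 1 := by linarith

lemma polyForm_lagW (ha : -1 < a) (p q : ℝ[X]) :
    polyForm (integrable_lagW_mul_pow (c := 1 / 2) ha one_half_pos) p (lagD a q) =
      ((4 : ℝ) • lagInt (neg_one_lt_two_mul_add_one ha) one_pos) (p * q) := by
  rw [lagD_eq, polyForm_eq_of_tail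
    (F := fun x => x ^ (a + 1) * Real.exp (-(1 / 2 * x)) * (C 2 * q).eval x) _ _ _
    (fun x hx => integral_Ioi_lagW_deriv ha one_half_pos _
      (not_lt.1 fun h => hx (lagW_of_nonpos h.le)))
    (lagInt_deriv ha one_half_pos _), LinearMap.smul_apply, smul_eq_mul, lagInt,
    polyIntegral_apply, ← integral_const_mul, ← integral_const_mul]
  congr 1
  ext x
  rcases lt_or_ge 0 x with hx | hx
  · rw [lagW_of_pos hx, lagW_of_pos hx, show 2 * a + 1 = a + (a + 1) by ring,
      Real.rpow_add hx a (a + 1),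
      show -(1 * x) = -(1 / 2 * x) + -(1 / 2 * x) by ring, Real.exp_add, eval_mul, eval_mul,
      eval_C]
    ring
  · rw [lagW_of_nonpos hx, lagW_of_nonpos hx]
    ring

/-- The normalisation of the Laguerre Pfaffian. -/
def normL (a : ℝ) (N : ℕ) : ℝ := ∏ j ∈ Finset.range N, 2 ^ (a + j + 1) *
  Real.Gamma (((j : ℕ) + 1 : ℝ) / 2) * Real.Gamma (a + ((j : ℝ) + 2) / 2) / √Real.pi

/-- Two duplication formulas: one produces the factorial in the Laguerre norm, the other, at
$a+i+1$, its $\Gamma(2a+2i+2)$. -/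
lemma normL_two_mul (ha : -1 < a) (m : ℕ) : normL a (2 * m) = ∏ i ∈ Finset.range m,
    ((4 : ℝ) • lagInt (neg_one_lt_two_mul_add_one ha) one_pos)
      (monicLaguerre (2 * a + 1) (2 * i) * monicLaguerre (2 * a + 1) (2 * i)) := by
  rw [normL, prod_range_two_mul]
  refine Finset.prod_congr rfl fun i _ => ?_
  rw [LinearMap.smul_apply, smul_eq_mul, lagInt_monicLaguerre_sq]
  have h1 := Gamma_half_mul_Gamma_half i
  have h2 := Real.Gamma_mul_Gamma_add_half (a + i + 1)
  rw [show a + (((2 * i : ℕ) : ℝ) + 2) / 2 = a + i + 1 by push_cast; ring,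
    show a + (((2 * i + 1 : ℕ) : ℝ) + 2) / 2 = a + i + 1 + 1 / 2 by push_cast; ring,
    show 2 * a + 1 + ((2 * i : ℕ) : ℝ) + 1 = 2 * (a + i + 1) by push_cast; ring]
  -- The powers of two in `normL` are chosen so that, against those of the duplication formulas,
  -- only the factor $4$ of $\mu$ survives.
  have h3 : (2 : ℝ) ^ (a + ((2 * i : ℕ) : ℝ) + 1) * 2 ^ (a + ((2 * i + 1 : ℕ) : ℝ) + 1) *
      2 ^ (1 - 2 * (a + i + 1)) = 4 * 2 ^ (2 * i) := by
    rw [← Real.rpow_add two_pos, ← Real.rpow_add two_pos,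
      show a + ((2 * i : ℕ) : ℝ) + 1 + (a + ((2 * i + 1 : ℕ) : ℝ) + 1) + (1 - 2 * (a + i + 1)) =
        ((2 * i : ℕ) : ℝ) + 2 by push_cast; ring, Real.rpow_add two_pos, Real.rpow_natCast]
    norm_num
    ring
  have h4 : ((1 : ℝ) / 2) ^ (2 * i) * 2 ^ (2 * i) = 1 := by rw [← mul_pow]; norm_num
  have h5 : √Real.pi ≠ 0 := (Real.sqrt_pos.2 Real.pi_pos).ne'
  generalize (2 : ℝ) ^ (a + ((2 * i : ℕ) : ℝ) + 1) = A at *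
  generalize (2 : ℝ) ^ (a + ((2 * i + 1 : ℕ) : ℝ) + 1) = B at *
  generalize (2 : ℝ) ^ (1 - 2 * (a + i + 1)) = E at *
  generalize Real.Gamma (((2 * i : ℕ) + 1 : ℝ) / 2) = G1 at *
  generalize Real.Gamma (((2 * i + 1 : ℕ) + 1 : ℝ) / 2) = G2 at *
  generalize Real.Gamma (a + i + 1) = G3 at *
  generalize Real.Gamma (a + i + 1 + 1 / 2) = G4 at *
  generalize Real.Gamma (2 * (a + i + 1)) = G5 at *
  generalize (((2 * i).factorial : ℕ) : ℝ) = F at *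
  generalize √Real.pi = P at *
  calc A * G1 * G3 / P * (B * G2 * G4 / P) = A * B * (G1 * G2) * (G3 * G4) / (P * P) := by
        field_simp
    _ = (A * B * E) * F * (1 / 2) ^ (2 * i) * G5 := by
        rw [h1, h2]; field_simp
    _ = 4 * (F * G5) := by
        rw [h3]; linear_combination (4 * F * G5) * h4

lemma monicLaguerre_orthogonal_smul (ha : -1 < a) (n : ℕ) (q : ℝ[X]) (hq : q.natDegree < n) :
    ((4 : ℝ) • lagInt (neg_one_lt_two_mul_add_one ha) one_pos)
      (monicLaguerre (2 * a + 1) n * q) = 0 := by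
  rw [LinearMap.smul_apply, lagInt_monicLaguerre_orthogonal _ n q hq, smul_zero]

lemma pfaffian_lagW_of_even (ha : -1 < a) {N : ℕ} (hN : Even N) (s : ℝ) :
    pfaffian (momentMatrix (fun x => (lagW a (1 / 2) x : ℂ) * markFactor s 1 x) N) =
      normL a N := by
  obtain ⟨m, rfl⟩ := even_iff_two_dvd.1 hN
  rw [pfaffian_momentMatrix_eq_prod (integrable_lagW_mul_pow ha one_half_pos)
    ((4 : ℝ) • lagInt (neg_one_lt_two_mul_add_one ha) one_pos)
    (monicLaguerre_monic (2 * a + 1)) (natDegree_monicLaguerre (2 * a + 1))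
    (monicLaguerre_orthogonal_smul ha) (fun p hp => (monic_lagD hp).1)
    (fun p hp => (monic_lagD hp).2) (polyForm_lagW ha) s rfl, normL_two_mul ha]

lemma pfaffian_lagW_of_odd (ha : -1 < a) {N : ℕ} (hN : Odd N) (s : ℝ) :
    pfaffian (bordered (momentMatrix (fun x => (lagW a (1 / 2) x : ℂ) * markFactor s 1 x) N)
      (momentVec (fun x => (lagW a (1 / 2) x : ℂ) * markFactor s 1 x) N)) = normL a N := by
  obtain ⟨m, rfl⟩ := hN
  rw [pfaffian_bordered_momentMatrix_eq_prod (integrable_lagW_mul_pow ha one_half_pos)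
    ((4 : ℝ) • lagInt (neg_one_lt_two_mul_add_one ha) one_pos)
    (monicLaguerre_monic (2 * a + 1)) (natDegree_monicLaguerre (2 * a + 1))
    (monicLaguerre_orthogonal_smul ha) (fun p hp => (monic_lagD hp).1)
    (fun p hp => (monic_lagD hp).2) (polyForm_lagW ha)
    (fun q => by rw [lagD_eq]; exact lagInt_deriv ha one_half_pos _) s rfl,
    ← normL_two_mul ha, normL, normL, Finset.prod_range_succ]
  have := lagInt_half_monicLaguerre_two_mul ha m
  rw [lagInt] at this
  rw [this, show ((2 * m : ℕ) + 1 : ℝ) / 2 = (m : ℝ) + 1 / 2 by push_cast; ring,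
    show a + (((2 * m : ℕ) : ℝ) + 2) / 2 = a + m + 1 by push_cast; ring]
  push_cast
  rfl

end Normalisation

/-! ## Matrix elements -/

section MatrixElements

lemma integral_prod_indicator_sign {f g : ℝ → ℝ} (hf : Integrable f) (hg : Integrable g)
    {S : Set ℝ} (hS : MeasurableSet S) :
    Integrable (fun z : ℝ × ℝ => S.indicator f z.1 * S.indicator g z.2 *
      Real.sign (z.2 - z.1)) ∧
    ∫ z : ℝ × ℝ, S.indicator f z.1 * S.indicator g z.2 * Real.sign (z.2 - z.1) =
      ∫ x in S, f x * ∫ y in S, g y * Real.sign (y - x) := by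
  have hint : Integrable (fun z : ℝ × ℝ => S.indicator f z.1 * S.indicator g z.2 *
      Real.sign (z.2 - z.1)) := by
    refine ((hf.indicator hS).mul_prod (hg.indicator hS)).mul_bdd (c := 1)
      ?_ (Filter.Eventually.of_forall fun z => abs_realSign_le_one _)
    exact (measurable_realSign.comp (measurable_snd.sub measurable_fst)).aestronglyMeasurable
  refine ⟨hint, (integral_prod _ hint).trans ?_⟩
  rw [← integral_indicator hS]
  refine integral_congr_ae (Filter.Eventually.of_forall fun x => ?_)
  dsimp only
  by_cases hx : x ∈ S
  · simp only [indicator_of_mem hx]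
    rw [← integral_indicator hS, ← integral_const_mul]
    refine integral_congr_ae (Filter.Eventually.of_forall fun y => ?_)
    by_cases hy : y ∈ S
    · simp only [indicator_of_mem hy, mul_assoc]
    · simp only [indicator_of_notMem hy, mul_zero, zero_mul]
  · simp only [indicator_of_notMem hx, zero_mul, integral_zero]

/-- Splitting of the skew inner product at `s`. -/
lemma sgnForm_mul_markFactor {f g : ℝ → ℝ} (hf : Integrable f) (hg : Integrable g) (s : ℝ)
    (ζ : ℂ) :
    sgnForm (fun x => (f x : ℂ) * markFactor s ζ x) (fun x => (g x : ℂ) * markFactor s ζ x) =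
      ((∫ x in Iic s, f x * ∫ y in Iic s, g y * Real.sign (y - x) : ℝ) : ℂ) +
      ζ * (((∫ x in Iic s, f x) * (∫ y in Ioi s, g y) -
        (∫ x in Iic s, g x) * (∫ y in Ioi s, f y) : ℝ) : ℂ) +
      ζ ^ 2 * ((∫ x in Ioi s, f x * ∫ y in Ioi s, g y * Real.sign (y - x) : ℝ) : ℂ) := by
  have h0 := integral_prod_indicator_sign hf hg (measurableSet_Iic (a := s))
  have h2 := integral_prod_indicator_sign hf hg (measurableSet_Ioi (a := s))
  have hfl := hf.indicator (measurableSet_Iic (a := s))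
  have hgl := hg.indicator (measurableSet_Iic (a := s))
  have hfr := hf.indicator (measurableSet_Ioi (a := s))
  have hgr := hg.indicator (measurableSet_Ioi (a := s))
  have h1i := (hfl.mul_prod hgr).sub (hfr.mul_prod hgl)
  have h1 : ∫ z : ℝ × ℝ, ((Iic s).indicator f z.1 * (Ioi s).indicator g z.2 -
      (Ioi s).indicator f z.1 * (Iic s).indicator g z.2) =
      (∫ x in Iic s, f x) * (∫ y in Ioi s, g y) - (∫ x in Iic s, g x) * (∫ y in Ioi s, f y) := by
    refine (integral_sub (hfl.mul_prod hgr) (hfr.mul_prod hgl)).trans ?_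
    rw [← integral_indicator measurableSet_Iic, ← integral_indicator measurableSet_Iic,
      ← integral_indicator measurableSet_Ioi, ← integral_indicator measurableSet_Ioi]
    refine congrArg₂ _ (integral_prod_mul _ _) ((integral_prod_mul _ _).trans (mul_comm _ _))
  rw [← h0.2, ← h1, ← h2.2, ← integral_complex_ofReal, ← integral_complex_ofReal,
    ← integral_complex_ofReal, ← integral_const_mul, ← integral_const_mul, sgnForm]
  have i0 : Integrable fun z : ℝ × ℝ => (((Iic s).indicator f z.1 * (Iic s).indicator g z.2 *
      Real.sign (z.2 - z.1) : ℝ) : ℂ) := h0.1.ofReal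
  have i1 : Integrable fun z : ℝ × ℝ => ζ * (((Iic s).indicator f z.1 * (Ioi s).indicator g z.2 -
      (Ioi s).indicator f z.1 * (Iic s).indicator g z.2 : ℝ) : ℂ) := h1i.ofReal.const_mul ζ
  have i2 : Integrable fun z : ℝ × ℝ => ζ ^ 2 * (((Ioi s).indicator f z.1 *
      (Ioi s).indicator g z.2 * Real.sign (z.2 - z.1) : ℝ) : ℂ) := h2.1.ofReal.const_mul _
  have i01 : Integrable fun z : ℝ × ℝ => (((Iic s).indicator f z.1 * (Iic s).indicator g z.2 *
      Real.sign (z.2 - z.1) : ℝ) : ℂ) + ζ * (((Iic s).indicator f z.1 * (Ioi s).indicator g z.2 -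
      (Ioi s).indicator f z.1 * (Iic s).indicator g z.2 : ℝ) : ℂ) := i0.add i1
  rw [← integral_add i0 i1, ← integral_add i01 i2]
  refine integral_congr_ae (Filter.Eventually.of_forall fun z => ?_)
  rcases z with ⟨x, y⟩
  -- Quadrant by quadrant: when $x$ and $y$ lie on opposite sides of $s$ the sign is constant, which
  -- is why the coefficient of $\zeta$ is a difference of products.
  by_cases hx : s < x <;> by_cases hy : s < y
  · simp [markFactor, hx, hy]; ring
  · have : Real.sign (y - x) = -1 := Real.sign_of_neg (by linarith)
    simp [markFactor, hx, hy, not_lt.1 hy, this]; ring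
  · have : Real.sign (y - x) = 1 := Real.sign_of_pos (by linarith)
    simp [markFactor, hx, hy, not_lt.1 hx, this]; ring
  · simp [markFactor, hx, hy, not_lt.1 hx, not_lt.1 hy]

lemma integral_mul_markFactor {f : ℝ → ℝ} (hf : Integrable f) (s : ℝ) (ζ : ℂ) :
    ∫ x, (f x : ℂ) * markFactor s ζ x =
      ((∫ x in Iic s, f x : ℝ) : ℂ) + ζ * ((∫ x in Ioi s, f x : ℝ) : ℂ) := by
  have i0 : Integrable fun x => (((Iic s).indicator f x : ℝ) : ℂ) :=
    (hf.indicator measurableSet_Iic).ofReal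
  have i1 : Integrable fun x => ζ * (((Ioi s).indicator f x : ℝ) : ℂ) :=
    (hf.indicator measurableSet_Ioi).ofReal.const_mul ζ
  rw [← integral_indicator measurableSet_Iic, ← integral_indicator measurableSet_Ioi,
    ← integral_complex_ofReal, ← integral_complex_ofReal, ← integral_const_mul,
    ← integral_add i0 i1]
  refine integral_congr_ae (Filter.Eventually.of_forall fun x => ?_)
  by_cases hx : s < x
  · simp [markFactor, hx]; ring
  · simp [markFactor, hx, not_lt.1 hx]

lemma momentMatrix_mul_markFactor {w : ℝ → ℝ} (s : ℝ) (ζ : ℂ) {N : ℕ} (j k : Fin N) :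
    momentMatrix (fun x => (w x : ℂ) * markFactor s ζ x) N j k =
      sgnForm (fun x => ((w x * x ^ (j : ℕ) : ℝ) : ℂ) * markFactor s ζ x)
        (fun x => ((w x * x ^ (k : ℕ) : ℝ) : ℂ) * markFactor s ζ x) := by
  rw [momentMatrix, Matrix.of_apply]
  congr 1 <;> ext x <;> push_cast <;> ring

lemma momentVec_mul_markFactor {w : ℝ → ℝ} (s : ℝ) (ζ : ℂ) {N : ℕ} (j : Fin N) :
    momentVec (fun x => (w x : ℂ) * markFactor s ζ x) N j =
      ∫ x, ((w x * x ^ (j : ℕ) : ℝ) : ℂ) * markFactor s ζ x := by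
  rw [momentVec]
  congr 1
  ext x
  push_cast
  ring

lemma weightG_eq : weightG = gaussW (1 / 2) := by
  ext x
  rw [weightG, gaussW]
  congr 1
  ring

lemma diagonal_conj {N : ℕ} (d : Fin N → ℂ) (A : Matrix (Fin N) (Fin N) ℂ) (j k : Fin N) :
    (Matrix.diagonal d * A * (Matrix.diagonal d).transpose) j k = d j * d k * A j k := by
  rw [Matrix.diagonal_transpose, Matrix.mul_diagonal, Matrix.diagonal_mul]
  ring

lemma matG_eq (N : ℕ) (ζ : ℂ) (s : ℝ) :
    matG N ζ s = Matrix.diagonal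
        (fun j : Fin N => ((1 / Real.Gamma (((j : ℕ) + 1 : ℝ) / 2) : ℝ) : ℂ)) *
      momentMatrix (fun x => (gaussW (1 / 2) x : ℂ) * markFactor s ζ x) N *
      (Matrix.diagonal
        (fun j : Fin N => ((1 / Real.Gamma (((j : ℕ) + 1 : ℝ) / 2) : ℝ) : ℂ))).transpose := by
  have hint := integrable_gaussW_mul_pow (c := 1 / 2) one_half_pos
  ext j k
  rw [diagonal_conj, momentMatrix_mul_markFactor, sgnForm_mul_markFactor (hint j) (hint k),
    matG, Matrix.of_apply, H0G, H1G, H2G]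
  have hw : ∀ (n : ℕ) (x : ℝ), x ^ (n + 1 - 1) * Real.exp (-x ^ 2 / 2) =
      gaussW (1 / 2) x * x ^ n := by
    intro n x
    rw [← weightG_eq, weightG, Nat.add_sub_cancel, mul_comm]
  simp only [hw]
  push_cast
  ring

lemma nuG_eq (N : ℕ) (ζ : ℂ) (s : ℝ) :
    (fun j : Fin N => nuG ζ (j + 1) s) = (Matrix.diagonal
        (fun j : Fin N => ((1 / Real.Gamma (((j : ℕ) + 1 : ℝ) / 2) : ℝ) : ℂ))).mulVec
      (momentVec (fun x => (gaussW (1 / 2) x : ℂ) * markFactor s ζ x) N) := by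
  have hint := integrable_gaussW_mul_pow (c := 1 / 2) one_half_pos
  ext j
  rw [Matrix.mulVec_diagonal, momentVec_mul_markFactor, integral_mul_markFactor (hint j), nuG]
  have hw : ∀ (n : ℕ) (x : ℝ), x ^ (n + 1 - 1) * Real.exp (-x ^ 2 / 2) =
      gaussW (1 / 2) x * x ^ n := by
    intro n x
    rw [← weightG_eq, weightG, Nat.add_sub_cancel, mul_comm]
  simp only [hw]
  push_cast
  ring

end MatrixElements

/-! ### Laguerre matrix elements: rescaling from $e^{-x}$ on $(0,s/2)$, $(s/2,\infty)$ to $e^{-t/2}$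
on $(0,s)$, $(s,\infty)$ -/

section LaguerreElements

lemma setIntegral_preimage_two_mul {S : Set ℝ} (hS : MeasurableSet S) (f : ℝ → ℝ) :
    ∫ x in (fun x => 2 * x) ⁻¹' S, f x = 1 / 2 * ∫ t in S, f (t / 2) := by
  have hS' : MeasurableSet ((fun x : ℝ => 2 * x) ⁻¹' S) := hS.preimage (measurable_const_mul 2)
  rw [← integral_indicator hS', ← integral_indicator hS]
  have h := Measure.integral_comp_mul_left (fun t => S.indicator (fun t => f (t / 2)) t) 2
  rw [abs_of_pos (by norm_num : (0 : ℝ) < 2⁻¹), smul_eq_mul] at h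
  rw [one_div, ← h]
  refine integral_congr_ae (Filter.Eventually.of_forall fun x => ?_)
  change _ = S.indicator (fun t => f (t / 2)) (2 * x)
  by_cases hx : 2 * x ∈ S
  · rw [indicator_of_mem hx, indicator_of_mem (show x ∈ (fun x : ℝ => 2 * x) ⁻¹' S from hx),
      mul_div_cancel_left₀ x two_ne_zero]
  · rw [indicator_of_notMem hx,
      indicator_of_notMem (show x ∉ (fun x : ℝ => 2 * x) ⁻¹' S from hx)]

/-- Rescaling of a half-line integral by a factor of two. -/
lemma setIntegral_rpow_mul_exp {S : Set ℝ} (hS : MeasurableSet S) (hS0 : S ⊆ Ioi 0) (b : ℝ)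
    (f : ℝ → ℝ) :
    ∫ x in (fun x => 2 * x) ⁻¹' S, x ^ b * Real.exp (-x) * f x =
      2 ^ (-(b + 1)) * ∫ t in S, lagW b (1 / 2) t * f (t / 2) := by
  rw [setIntegral_preimage_two_mul hS, ← integral_const_mul, ← integral_const_mul]
  refine setIntegral_congr_fun hS fun t ht => ?_
  have ht0 : 0 < t := hS0 ht
  rw [lagW_of_pos ht0, Real.div_rpow ht0.le two_pos.le, neg_add, Real.rpow_add two_pos,
    Real.rpow_neg two_pos.le, Real.rpow_neg_one, show -(1 / 2 * t) = -(t / 2) by ring]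
  ring

/-- The sign is invariant under dilation, so each of the two integrals contributes only its own
power of two. -/
lemma setIntegral_rpow_mul_exp_sign {S : Set ℝ} (hS : MeasurableSet S) (hS0 : S ⊆ Ioi 0)
    (b b' : ℝ) :
    (∫ x in (fun x => 2 * x) ⁻¹' S, x ^ b * Real.exp (-x) *
      ∫ y in (fun x => 2 * x) ⁻¹' S, y ^ b' * Real.exp (-y) * Real.sign (y - x)) =
      2 ^ (-(b + 1)) * 2 ^ (-(b' + 1)) * ∫ t in S, lagW b (1 / 2) t *
        ∫ u in S, lagW b' (1 / 2) u * Real.sign (u - t) := by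
  have hsign : ∀ u t : ℝ, Real.sign (u / 2 - t / 2) = Real.sign (u - t) := by
    intro u t
    rw [← sub_div]
    rcases lt_trichotomy (u - t) 0 with h | h | h
    · rw [Real.sign_of_neg h, Real.sign_of_neg (by linarith)]
    · rw [h, zero_div]
    · rw [Real.sign_of_pos h, Real.sign_of_pos (by linarith)]
  rw [setIntegral_rpow_mul_exp hS hS0, mul_assoc, ← integral_const_mul (2 ^ (-(b' + 1)))]
  congr 2
  ext t
  rw [setIntegral_rpow_mul_exp hS hS0]
  simp only [hsign]
  ring

lemma preimage_two_mul_Ioi (s : ℝ) : (fun x : ℝ => 2 * x) ⁻¹' Ioi s = Ioi (s / 2) := by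
  ext x
  simp only [mem_preimage, mem_Ioi]
  constructor <;> intro h <;> linarith

lemma preimage_two_mul_Ioc (s : ℝ) : (fun x : ℝ => 2 * x) ⁻¹' Ioc 0 s = Ioc 0 (s / 2) := by
  ext x
  simp only [mem_preimage, mem_Ioc]
  constructor <;> rintro ⟨h, h'⟩ <;> constructor <;> linarith

/-- Reconciles integrals starting at $0$ with the splitting of the whole line at $s$. -/
lemma setIntegral_Ioc_lagW (b c s : ℝ) (f : ℝ → ℝ) :
    ∫ t in Ioc 0 s, lagW b c t * f t = ∫ t in Iic s, lagW b c t * f t := by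
  refine (setIntegral_eq_of_subset_of_forall_sdiff_eq_zero measurableSet_Iic
    Ioc_subset_Iic_self
    fun x hx => ?_).symm
  have : x ≤ 0 := by
    by_contra h
    exact hx.2 ⟨not_le.1 h, hx.1⟩
  rw [lagW_of_nonpos this, zero_mul]

variable {s : ℝ}

lemma intervalIntegral_rpow_mul_exp (hs : 0 ≤ s) (b : ℝ) :
    ∫ x in (0 : ℝ)..s / 2, x ^ b * Real.exp (-x) =
      2 ^ (-(b + 1)) * ∫ t in Iic s, lagW b (1 / 2) t := by
  have h := setIntegral_rpow_mul_exp (measurableSet_Ioc (a := (0 : ℝ)) (b := s))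
    Ioc_subset_Ioi_self b (fun _ => 1)
  rw [preimage_two_mul_Ioc, setIntegral_Ioc_lagW] at h
  rw [intervalIntegral.integral_of_le (by linarith)]
  simpa only [mul_one] using h

lemma integral_Ioi_rpow_mul_exp (hs : 0 ≤ s) (b : ℝ) :
    ∫ x in Ioi (s / 2), x ^ b * Real.exp (-x) =
      2 ^ (-(b + 1)) * ∫ t in Ioi s, lagW b (1 / 2) t := by
  have h := setIntegral_rpow_mul_exp (measurableSet_Ioi (a := s)) (Ioi_subset_Ioi hs) b
    (fun _ => 1)
  rw [preimage_two_mul_Ioi] at h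
  simpa only [mul_one] using h

lemma intervalIntegral_rpow_mul_exp_sign (hs : 0 ≤ s) (b b' : ℝ) :
    (∫ x in (0 : ℝ)..s / 2, x ^ b * Real.exp (-x) *
      ∫ y in (0 : ℝ)..s / 2, y ^ b' * Real.exp (-y) * Real.sign (y - x)) =
      2 ^ (-(b + 1)) * 2 ^ (-(b' + 1)) * ∫ t in Iic s, lagW b (1 / 2) t *
        ∫ u in Iic s, lagW b' (1 / 2) u * Real.sign (u - t) := by
  have h := setIntegral_rpow_mul_exp_sign (measurableSet_Ioc (a := (0 : ℝ)) (b := s))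
    Ioc_subset_Ioi_self b b'
  simp only [preimage_two_mul_Ioc, setIntegral_Ioc_lagW] at h
  simp only [intervalIntegral.integral_of_le (by linarith : (0 : ℝ) ≤ s / 2)]
  exact h

lemma integral_Ioi_rpow_mul_exp_sign (hs : 0 ≤ s) (b b' : ℝ) :
    (∫ x in Ioi (s / 2), x ^ b * Real.exp (-x) *
      ∫ y in Ioi (s / 2), y ^ b' * Real.exp (-y) * Real.sign (y - x)) =
      2 ^ (-(b + 1)) * 2 ^ (-(b' + 1)) * ∫ t in Ioi s, lagW b (1 / 2) t *
        ∫ u in Ioi s, lagW b' (1 / 2) u * Real.sign (u - t) := by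
  have h := setIntegral_rpow_mul_exp_sign (measurableSet_Ioi (a := s)) (Ioi_subset_Ioi hs) b b'
  simpa only [preimage_two_mul_Ioi] using h

lemma weightL_eq (a : ℝ) : weightL a = lagW a (1 / 2) := by
  ext x
  rw [weightL, lagW, show -(1 / 2 * x) = -x / 2 by ring]

/-- The scaling factors of the Laguerre matrix elements. -/
def scaleL (a : ℝ) (j : ℕ) : ℝ := 2 ^ (-(a + j + 1)) / Real.Gamma (a + (j + 1))

variable {a : ℝ}

lemma matL_eq (ha : -1 < a) (N : ℕ) (ζ : ℂ) (hs : 0 ≤ s) :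
    matL a N ζ (s / 2) = Matrix.diagonal (fun j : Fin N => ((scaleL a j : ℝ) : ℂ)) *
      momentMatrix (fun x => (lagW a (1 / 2) x : ℂ) * markFactor s ζ x) N *
      (Matrix.diagonal (fun j : Fin N => ((scaleL a j : ℝ) : ℂ))).transpose := by
  have hint := integrable_lagW_mul_pow (c := 1 / 2) ha one_half_pos
  ext j k
  rw [diagonal_conj, momentMatrix_mul_markFactor, sgnForm_mul_markFactor (hint j) (hint k),
    matL, Matrix.of_apply, H0L, H1L, H2L, intervalIntegral_rpow_mul_exp_sign hs,
    integral_Ioi_rpow_mul_exp_sign hs, intervalIntegral_rpow_mul_exp hs,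
    intervalIntegral_rpow_mul_exp hs, integral_Ioi_rpow_mul_exp hs, integral_Ioi_rpow_mul_exp hs]
  have hb : ∀ n : ℕ, a + ((n + 1 : ℕ) : ℝ) - 1 = a + n := fun n => by push_cast; ring
  simp only [hb, lagW_mul_pow, scaleL]
  push_cast
  ring

lemma nuL_eq (ha : -1 < a) (N : ℕ) (ζ : ℂ) (hs : 0 ≤ s) :
    (fun j : Fin N => nuL a ζ (j + 1) (s / 2)) =
      (Matrix.diagonal (fun j : Fin N => ((scaleL a j : ℝ) : ℂ))).mulVec
        (momentVec (fun x => (lagW a (1 / 2) x : ℂ) * markFactor s ζ x) N) := by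
  have hint := integrable_lagW_mul_pow (c := 1 / 2) ha one_half_pos
  ext j
  rw [Matrix.mulVec_diagonal, momentVec_mul_markFactor, integral_mul_markFactor (hint j), nuL,
    intervalIntegral_rpow_mul_exp hs, integral_Ioi_rpow_mul_exp hs]
  have hb : ∀ n : ℕ, a + ((n + 1 : ℕ) : ℝ) - 1 = a + n := fun n => by push_cast; ring
  simp only [hb, lagW_mul_pow, scaleL]
  push_cast
  ring

/-! ### Cancellation of the normalisation against the prefactors -/

lemma normG_ne_zero (N : ℕ) : normG N ≠ 0 :=
  Finset.prod_ne_zero_iff.2 fun j _ => mul_ne_zero (by positivity)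
    (Real.Gamma_pos_of_pos (by positivity)).ne'

lemma two_rpow_mul_prod_eq (N : ℕ) : (2 : ℝ) ^ (-(N : ℝ) / 2) *
    ∏ j : Fin N, (1 / Real.Gamma (((j : ℕ) + 1 : ℝ) / 2)) = (normG N)⁻¹ := by
  have h2 : (2 : ℝ) ^ (-(N : ℝ) / 2) = ((√2) ^ N)⁻¹ := by
    rw [Real.sqrt_eq_rpow, ← Real.rpow_natCast, ← Real.rpow_mul two_pos.le,
      ← Real.rpow_neg two_pos.le]
    congr 1
    ring
  rw [h2, normG, Finset.prod_mul_distrib, Finset.prod_const, Finset.card_range, mul_inv,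
    ← Finset.prod_inv_distrib, Finset.prod_range]
  simp only [one_div]

lemma normL_ne_zero (ha : -1 < a) (N : ℕ) : normL a N ≠ 0 := by
  refine Finset.prod_ne_zero_iff.2 fun j _ => ?_
  have h1 : 0 < Real.Gamma (((j : ℕ) + 1 : ℝ) / 2) := Real.Gamma_pos_of_pos (by positivity)
  have h2 : 0 < Real.Gamma (a + ((j : ℝ) + 2) / 2) := Real.Gamma_pos_of_pos (by
    have : (0 : ℝ) ≤ j := Nat.cast_nonneg j
    linarith)
  positivity

/-- The $\Gamma(a+j)$ of the weights cancel inside the product; the powers of two in `normL` are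
those of the rescaling. -/
lemma constL_mul_prod_eq (ha : -1 < a) (N : ℕ) :
    constL a N * ∏ j : Fin N, scaleL a j = (normL a N)⁻¹ := by
  have hcon : constL a N = ∏ j ∈ Finset.range N, √Real.pi * Real.Gamma (a + (j + 1)) /
      (Real.Gamma (((j : ℕ) + 1 : ℝ) / 2) * Real.Gamma (a + ((j : ℝ) + 2) / 2)) := by
    rw [constL]
    induction N with
    | zero => simp
    | succ n ih =>
      rw [Finset.prod_Icc_succ_top (by omega), ih, Finset.prod_range_succ]
      push_cast
      rw [show a + ((n : ℝ) + 1 + 1) / 2 = a + ((n : ℝ) + 2) / 2 by ring]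
  rw [hcon, ← Finset.prod_range, ← Finset.prod_mul_distrib, normL, ← Finset.prod_inv_distrib]
  refine Finset.prod_congr rfl fun j _ => ?_
  have h : Real.Gamma (a + (j + 1)) ≠ 0 := (Real.Gamma_pos_of_pos (by
    have : (0 : ℝ) ≤ j := Nat.cast_nonneg j
    linarith)).ne'
  rw [scaleL, Real.rpow_neg two_pos.le]
  field_simp

end LaguerreElements

end OrthogonalEnsembles

end

theorem mainTheorem1 (N : ℕ) (ζ : ℂ) :
    (∀ s : ℝ,
      (Even N →
        OrthogonalEnsembles.genFun OrthogonalEnsembles.weightG N s ζ =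
          (((2 : ℝ) ^ (-(N : ℝ) / 2) : ℝ) : ℂ) *
            OrthogonalEnsembles.pfaffian (OrthogonalEnsembles.matG N ζ s)) ∧
      (Odd N →
        OrthogonalEnsembles.genFun OrthogonalEnsembles.weightG N s ζ =
          (((2 : ℝ) ^ (-(N : ℝ) / 2) : ℝ) : ℂ) *
            OrthogonalEnsembles.pfaffian
              (OrthogonalEnsembles.bordered (OrthogonalEnsembles.matG N ζ s)
                (fun j => OrthogonalEnsembles.nuG ζ (j + 1) s)))) ∧
    (∀ a : ℝ, -1 < a → ∀ s : ℝ, 0 ≤ s →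
      (Even N →
        OrthogonalEnsembles.genFun (OrthogonalEnsembles.weightL a) N s ζ =
          (OrthogonalEnsembles.constL a N : ℂ) *
            OrthogonalEnsembles.pfaffian (OrthogonalEnsembles.matL a N ζ (s / 2))) ∧
      (Odd N →
        OrthogonalEnsembles.genFun (OrthogonalEnsembles.weightL a) N s ζ =
          (OrthogonalEnsembles.constL a N : ℂ) *
            OrthogonalEnsembles.pfaffian
              (OrthogonalEnsembles.bordered (OrthogonalEnsembles.matL a N ζ (s / 2))
                (fun j => OrthogonalEnsembles.nuL a ζ (j + 1) (s / 2))))) := by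
  open OrthogonalEnsembles in
  refine ⟨fun s => ⟨fun hN => ?_, fun hN => ?_⟩, fun a ha s hs => ⟨fun hN => ?_, fun hN => ?_⟩⟩
  -- All four cases run alike: the Pfaffian at $\zeta=1$ is an explicit nonzero constant, and the
  -- prefactor times the determinant of the diagonal scaling is its inverse.
  · have h1 := pfaffian_gaussW_of_even hN s
    rw [weightG_eq, genFun_eq_of_even (fun x => (gaussW_pos _ x).le)
      (integrable_gaussW_mul_pow one_half_pos) hN s ζ
      (by rw [h1]; exact_mod_cast normG_ne_zero N), h1, matG_eq, pfaffian_conj hN,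
      Matrix.det_diagonal, ← Complex.ofReal_prod, ← mul_assoc, ← Complex.ofReal_mul,
      two_rpow_mul_prod_eq, Complex.ofReal_inv, div_eq_inv_mul]
  · have h1 := pfaffian_gaussW_of_odd hN s
    rw [weightG_eq, genFun_eq_of_odd (fun x => (gaussW_pos _ x).le)
      (integrable_gaussW_mul_pow one_half_pos) hN s ζ
      (by rw [h1]; exact_mod_cast normG_ne_zero N), h1, matG_eq, nuG_eq,
      pfaffian_bordered_conj hN,
      Matrix.det_diagonal, ← Complex.ofReal_prod, ← mul_assoc, ← Complex.ofReal_mul,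
      two_rpow_mul_prod_eq, Complex.ofReal_inv, div_eq_inv_mul]
  · have h1 := pfaffian_lagW_of_even ha hN s
    rw [weightL_eq, genFun_eq_of_even (lagW_nonneg _ _)
      (integrable_lagW_mul_pow ha one_half_pos) hN s ζ
      (by rw [h1]; exact_mod_cast normL_ne_zero ha N), h1, matL_eq ha N ζ hs, pfaffian_conj hN,
      Matrix.det_diagonal, ← Complex.ofReal_prod, ← mul_assoc, ← Complex.ofReal_mul,
      constL_mul_prod_eq ha, Complex.ofReal_inv, div_eq_inv_mul]
  · have h1 := pfaffian_lagW_of_odd ha hN s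
    rw [weightL_eq, genFun_eq_of_odd (lagW_nonneg _ _)
      (integrable_lagW_mul_pow ha one_half_pos) hN s ζ
      (by rw [h1]; exact_mod_cast normL_ne_zero ha N), h1, matL_eq ha N ζ hs, nuL_eq ha N ζ hs,
      pfaffian_bordered_conj hN,
      Matrix.det_diagonal, ← Complex.ofReal_prod, ← mul_assoc, ← Complex.ofReal_mul,
      constL_mul_prod_eq ha, Complex.ofReal_inv, div_eq_inv_mul]
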